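/- Let $\Delta,h\in\mathbb{C}$ with $2h\notin\{0,-1,-2,\dots\}$ (here $h=\tilde\Delta$ is the dimension of the exchanged operator). For $c\in\mathbb{C}$ let $|h\rangle$ be the primary state of the Verma module with highest weight $h$ over the Virasoro algebra $[L_m,L_n]=(m-n)L_{m+n}+\frac{c}{12}m(m^2-1)\delta_{m+n,0}$, with $\langle h|h\rangle=1$ and $L_n^\dagger=L_{-n}$, and let $\phi_\Delta(z)$ be a primary field, $[L_m,\phi_\Delta]=z^m(z\partial_z+(m+1)\Delta)\phi_\Delta$, with $\langle h|\phi_\Delta(z)|h\rangle\neq0$. For partitions $M=(m_1\ge\dots\ge m_k\ge1)$ of $n$ put $|M,h\rangle=L_{-m_1}\cdots L_{-m_k}|h\rangle$, let $B_{M|N}=\langle h,M|N,h\rangle$ be the Gram matrix at level $n$, with inverse $B^{M|N}$, and let $$\mathcal V_n(\Delta,h,c)=\sum_{|M|=|N|=n}B^{M|N}\,\frac{\langle h,M|\phi_\Delta(z)|N,h\rangle}{\langle h|\phi_\Delta(z)|h\rangle}$$ be the coefficients of the one-point Virasoro torus block $q^{c/24-h}\,\mathcal V(\Delta,h,c|q)=\sum_{n\ge0}\mathcal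 V_n(\Delta,h,c)\,q^n$. Let $$\mathcal F(\Delta,h|q)=\sum_{n\ge0}\mathcal F_n(\Delta,h)\,q^n,\qquad \mathcal F_n(\Delta,h)=\frac{\langle h|L_1^n\,\phi_\Delta(z)\,L_{-1}^n|h\rangle}{\langle h|\phi_\Delta(z)|h\rangle\,\langle h|L_1^nL_{-1}^n|h\rangle}$$ be the global torus block; the matrix elements that define $\mathcal F_n$ may be computed in the Verma module of any central charge. Then for every $n$ the Gram matrix at level $n$ is invertible for all $c\in\mathbb{C}$ with $|c|$ large enough, and there is exactly one formal power series $\mathcal L(\Delta,h|q)=\sum_{n\ge0}\mathcal L_n(\Delta,h)\,q^n$, the light torus block, such that for every $n$, at fixed $\Delta$ and $h$, $$\mathcal V_n(\Delta,h,c)=\mathcal L_n(\Delta,h)+O(c^{-1}),\qquad c\to\infty .$$ It satisfies, as an identity of formal power series in $q$, $$\mathcal L(\Delta,h|q)=\frac{1-q}{\varphi(q)}\,\mathcal F(\Delta,h|q),\qquad \varphi(q)=\prod_{n=1}^\infty(1-q^n),$$ that is, in components, $$\mathcal L_n(\Delta,h)=\sum_{k=0}^n p_1(n-k)\,\mathcal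 F_k(\Delta,h)\qquad(n\ge0),$$ where $p_1(m)$ is the number of partitions of $m$ with no part equal to $1$ (so $p_1(0)=1$). -/

import Mathlib

namespace TorusBlock

/-- The central term `(c/12) m (m^2 - 1) δ_{m+n,0}` of the Virasoro algebra. -/
noncomputable def central (c : ℂ) (m n : ℤ) : ℂ :=
  if m + n = 0 then c / 12 * m * ((m : ℂ) ^ 2 - 1) else 0

/-- The defining relations of the Virasoro algebra at central charge `c`:
`[L_m, L_n] = (m - n) L_{m+n} + (c/12) m (m^2 - 1) δ_{m+n,0}`. -/
inductive VirasoroRel (c : ℂ) : FreeAlgebra ℂ ℤ → FreeAlgebra ℂ ℤ → Prop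
  | comm (m n : ℤ) : VirasoroRel c
      (FreeAlgebra.ι ℂ m * FreeAlgebra.ι ℂ n - FreeAlgebra.ι ℂ n * FreeAlgebra.ι ℂ m)
      (((m : ℂ) - n) • FreeAlgebra.ι ℂ (m + n)
        + central c m n • 1)

/-- The universal enveloping algebra of the Virasoro algebra with the central element set equal
to `c`: the associative algebra generated by the `L_n`, `n ∈ ℤ`, and the Virasoro relations. -/
abbrev VirasoroAlg (c : ℂ) : Type := RingQuot (VirasoroRel c)

/-- The Virasoro generator `L_n`. -/
noncomputable def gen (c : ℂ) (n : ℤ) : VirasoroAlg c :=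
  RingQuot.mkAlgHom ℂ (VirasoroRel c) (FreeAlgebra.ι ℂ n)

/-- The left ideal generated by `L_n`, `n > 0`, and `L_0 - h`. -/
def vermaIdeal (c h : ℂ) : Submodule (VirasoroAlg c) (VirasoroAlg c) :=
  Submodule.span (VirasoroAlg c)
    ({x | ∃ n : ℤ, 0 < n ∧ x = gen c n} ∪ {gen c 0 - h • (1 : VirasoroAlg c)})

/-- The Verma module of central charge `c` and highest weight (conformal dimension) `h`. -/
abbrev Verma (c h : ℂ) : Type := VirasoroAlg c ⧸ vermaIdeal c h

/-- The primary state `|h⟩`. -/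
def vac (c h : ℂ) : Verma c h := Submodule.Quotient.mk 1

/-- The action of `L_n` on the Verma module. -/
noncomputable def vir (c h : ℂ) (n : ℤ) : Module.End ℂ (Verma c h) :=
  Algebra.lsmul ℂ ℂ (Verma c h) (gen c n)

/-- `S x y = ⟨x | y⟩` is the contravariant (Shapovalov) bilinear form on the Verma module:
`⟨h | h⟩ = 1`, and `L_{-n}` is the adjoint of `L_n`. -/
structure IsContravariantForm (c h : ℂ) (S : Verma c h →ₗ[ℂ] Verma c h →ₗ[ℂ] ℂ) : Prop where
  vac_vac : S (vac c h) (vac c h) = 1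
  adjoint : ∀ (n : ℤ) (x y : Verma c h), S (vir c h (-n) x) y = S x (vir c h n y)

/-- `φ k x y = ⟨x | φ_k | y⟩` are the matrix elements of the modes of a primary field
`φ(z) = ∑_k φ_k z^{-k-Δ}` of conformal dimension `Δ`, normalised by `⟨h | φ_0 | h⟩ = 1`
(the only nonzero mode between primary states, so that `⟨h | φ(z) | h⟩ = z^{-Δ}`).
The covariance law `[L_m, φ(z)] = z^m (z ∂_z + (m + 1) Δ) φ(z)` reads
`[L_m, φ_k] = ((Δ - 1) m - k) φ_{k+m}` in modes, and `⟨x | L_m` is the bra of `L_{-m} x`. -/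
structure IsPrimaryField (c h Δ : ℂ) (φ : ℤ → Verma c h →ₗ[ℂ] Verma c h →ₗ[ℂ] ℂ) : Prop where
  vac_vac : φ 0 (vac c h) (vac c h) = 1
  comm : ∀ (m k : ℤ) (x y : Verma c h),
    φ k (vir c h (-m) x) y - φ k x (vir c h m y) = ((Δ - 1) * m - k) * φ (k + m) x y

/-- A family of operators satisfying the Virasoro relations. -/
def IsVirRep {M : Type} [AddCommGroup M] [Module ℂ M] (c : ℂ) (T : ℤ → Module.End ℂ M) : Prop :=
  ∀ (m n : ℤ) (x : M), T m (T n x) - T n (T m x) = ((m : ℂ) - n) • T (m + n) x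
    + central c m n • x

theorem isVirRep_vir (c h : ℂ) : IsVirRep c (vir c h) := by
  intro m n x
  have := RingQuot.mkAlgHom_rel ℂ (VirasoroRel.comm (c := c) m n)
  simp only [map_sub, map_mul, map_add, map_smul, map_one] at this
  have h2 := congrArg (fun a : VirasoroAlg c => a • x) this
  rw [sub_smul, add_smul, mul_smul, mul_smul, smul_assoc, smul_assoc, one_smul] at h2
  exact h2

theorem vir_vac_pos (c h : ℂ) {n : ℤ} (hn : 0 < n) : vir c h n (vac c h) = 0 := by
  have : gen c n • (1 : VirasoroAlg c) ∈ vermaIdeal c h := by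
    rw [smul_eq_mul, mul_one]
    exact Submodule.subset_span (Or.inl ⟨n, hn, rfl⟩)
  exact (Submodule.Quotient.mk_eq_zero _).2 this

theorem vir_vac_zero (c h : ℂ) : vir c h 0 (vac c h) = h • vac c h := by
  have : gen c 0 • (1 : VirasoroAlg c) - h • (1 : VirasoroAlg c) ∈ vermaIdeal c h := by
    rw [smul_eq_mul, mul_one]
    exact Submodule.subset_span (Or.inr rfl)
  exact (Submodule.Quotient.eq _).2 this

/-- Universal property of the Verma module. -/
theorem exists_vermaLift {M : Type} [AddCommGroup M] [Module ℂ M] (c h : ℂ)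
    (T : ℤ → Module.End ℂ M) (hT : IsVirRep c T) (u : M)
    (hu : ∀ n : ℤ, 0 < n → T n u = 0) (hu0 : T 0 u = h • u) :
    ∃ f : Verma c h →ₗ[ℂ] M, f (vac c h) = u ∧ ∀ n x, f (vir c h n x) = T n (f x) := by
  have hrel : ∀ ⦃x y⦄, VirasoroRel c x y → FreeAlgebra.lift ℂ T x = FreeAlgebra.lift ℂ T y := by
    rintro _ _ ⟨m, n⟩
    ext x
    simpa using hT m n x
  let ρ : VirasoroAlg c →ₐ[ℂ] Module.End ℂ M :=
    RingQuot.liftAlgHom ℂ ⟨FreeAlgebra.lift ℂ T, hrel⟩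
  have hρ : ∀ n, ρ (gen c n) = T n := by
    intro n
    simp [ρ, gen]
  let g : VirasoroAlg c →ₗ[ℂ] M := (LinearMap.applyₗ u).comp ρ.toLinearMap
  have hg : ∀ x, g x = ρ x u := fun x => rfl
  have hker : (vermaIdeal c h).restrictScalars ℂ ≤ LinearMap.ker g := by
    intro x hx
    rw [LinearMap.mem_ker, hg]
    change x ∈ vermaIdeal c h at hx
    refine Submodule.span_induction ?_ ?_ ?_ ?_ hx
    · rintro y (⟨n, hn, rfl⟩ | rfl)
      · rw [hρ, hu n hn]
      · simp [hρ, hu0]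
    · simp
    · intro y z _ _ hy hz
      simp [hy, hz]
    · intro a y _ hy
      simp [hy]
  refine ⟨(((vermaIdeal c h).restrictScalars ℂ).liftQ g hker).comp
    (Submodule.Quotient.restrictScalarsEquiv ℂ (vermaIdeal c h)).symm.toLinearMap, ?_, ?_⟩
  · change g 1 = u
    simp [hg]
  · intro n x
    obtain ⟨x, rfl⟩ := Submodule.Quotient.mk_surjective _ x
    change g (gen c n * x) = T n (g x)
    simp [hg, hρ]

/-- Relations among the creation operators `e_a = L_{-a}`, `a ≥ 1`. -/
inductive NegRel : FreeAlgebra ℂ ℕ+ → FreeAlgebra ℂ ℕ+ → Prop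
  | comm (a b : ℕ+) : NegRel
      (FreeAlgebra.ι ℂ a * FreeAlgebra.ι ℂ b - FreeAlgebra.ι ℂ b * FreeAlgebra.ι ℂ a)
      (((b : ℂ) - a) • FreeAlgebra.ι ℂ (a + b))

/-- The associative algebra generated by the creation operators. -/
abbrev NegAlg : Type := RingQuot NegRel

/-- The creation operator `e_a`. -/
noncomputable def neg (a : ℕ+) : NegAlg := RingQuot.mkAlgHom ℂ NegRel (FreeAlgebra.ι ℂ a)

theorem neg_comm (a b : ℕ+) :
    neg a * neg b - neg b * neg a = ((b : ℂ) - a) • neg (a + b) := by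
  simpa [neg] using RingQuot.mkAlgHom_rel ℂ (NegRel.comm a b)

theorem exists_negLift {M : Type} [AddCommGroup M] [Module ℂ M] (T : ℕ+ → Module.End ℂ M)
    (hT : ∀ a b x, T a (T b x) - T b (T a x) = ((b : ℂ) - a) • T (a + b) x) :
    ∃ f : NegAlg →ₐ[ℂ] Module.End ℂ M, ∀ a, f (neg a) = T a := by
  have hrel : ∀ ⦃x y⦄, NegRel x y → FreeAlgebra.lift ℂ T x = FreeAlgebra.lift ℂ T y := by
    rintro _ _ ⟨a, b⟩
    ext x
    simpa using hT a b x
  exact ⟨RingQuot.liftAlgHom ℂ ⟨FreeAlgebra.lift ℂ T, hrel⟩, fun a => by simp [neg]⟩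

theorem negAlg_induction {P : NegAlg → Prop} (one : P 1)
    (add : ∀ x y, P x → P y → P (x + y)) (smul : ∀ (r : ℂ) x, P x → P (r • x))
    (mul : ∀ a x, P x → P (neg a * x)) (x : NegAlg) : P x := by
  obtain ⟨x, rfl⟩ := RingQuot.mkAlgHom_surjective ℂ NegRel x
  suffices ∀ y, P y → P (RingQuot.mkAlgHom ℂ NegRel x * y) by simpa using this 1 one
  induction x using FreeAlgebra.induction with
  | grade0 r => 
    intro y hy
    rw [AlgHom.commutes, ← Algebra.smul_def]
    exact smul r y hy
  | grade1 a => exact fun y hy => mul a y hy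
  | mul a b ha hb => 
    intro y hy
    rw [map_mul, mul_assoc]
    exact ha _ (hb _ hy)
  | add a b ha hb =>
    intro y hy
    rw [map_add, add_mul]
    exact add _ _ (ha _ hy) (hb _ hy)

theorem central_swap (c : ℂ) (m n : ℤ) : central c m n = - central c n m := by
  unfold central
  rw [add_comm n m]
  split_ifs with hmn
  · obtain rfl : n = -m := by omega
    push_cast
    ring
  · simp

theorem central_jacobi (c : ℂ) (m n b : ℤ) :
    ((m : ℂ) + b) * central c (m - b) n + ((n : ℂ) + b) * central c m (n - b)
      = ((m : ℂ) - n) * central c (m + n) (-b) := by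
  unfold central
  by_cases hb : m + n - b = 0
  · rw [if_pos (by omega), if_pos (by omega), if_pos (by omega)]
    obtain rfl : b = m + n := by omega
    push_cast
    ring
  · rw [if_neg (by omega), if_neg (by omega), if_neg (by omega)]
    ring

theorem central_neg (c : ℂ) (m n : ℤ) : central c (-n) (-m) = central c m n := by
  unfold central
  by_cases hb : m + n = 0
  · rw [if_pos (by omega), if_pos hb]
    obtain rfl : n = -m := by omega
    push_cast
    ring
  · rw [if_neg (by omega), if_neg hb]

/-- The Virasoro action on the span of the words in the creation operators. -/
theorem exists_negRep (c h : ℂ) : ∃ T : ℤ → Module.End ℂ NegAlg,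
    IsVirRep c T ∧ (∀ n : ℤ, 0 < n → T n 1 = 0) ∧ T 0 1 = h • 1 ∧
      ∀ (a : ℕ+) x, T (-a) x = neg a * x := by
  let M : ℕ+ → Module.End ℂ ((ℤ → NegAlg) × NegAlg) := fun b =>
    { toFun := fun p => (fun n => neg b * p.1 n + ((n : ℂ) + b) • p.1 (n - b)
          + central c n (-b) • p.2, neg b * p.2)
      map_add' := by
        intro p q
        ext n
        · simp only [Prod.fst_add, Prod.snd_add, Pi.add_apply, mul_add, smul_add]
          abel
        · simp [mul_add]
      map_smul' := by
        intro r p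
        ext n
        · simp [smul_add, smul_comm r]
        · simp }
  have hM1 : ∀ b p n, (M b p).1 n = neg b * p.1 n + ((n : ℂ) + b) • p.1 (n - b)
          + central c n (-b) • p.2 := fun _ _ _ => rfl
  have hM2 : ∀ b p, (M b p).2 = neg b * p.2 := fun _ _ => rfl
  obtain ⟨f, hf⟩ := exists_negLift M (by
    intro a b p
    ext n
    · have hab := congrArg (· * p.1 n) (neg_comm a b)
      simp only [sub_mul, smul_mul_assoc, mul_assoc] at hab
      have e1 : n - (b : ℤ) - a = n - a - b := by ring
      have e2 : n - ((a + b : ℕ+) : ℤ) = n - a - b := by push_cast; ring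
      have hz : ((n : ℂ) + a) * central c (n - a) (-b) - ((n : ℂ) + b) * central c (n - b) (-a)
          = ((b : ℂ) - a) * central c n (-((a + b : ℕ+) : ℤ)) := by
        unfold central
        by_cases hb : n - a - b = 0
        · rw [if_pos (by omega), if_pos (by omega), if_pos (by push_cast; omega)]
          obtain rfl : n = a + b := by omega
          push_cast
          ring
        · rw [if_neg (by omega), if_neg (by omega), if_neg (by push_cast; omega)]
          ring
      simp only [Prod.fst_sub, Prod.smul_fst, Pi.sub_apply, Pi.smul_apply, hM1, hM2, e1, e2,
        mul_add, mul_smul_comm, smul_add]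
      push_cast at hz ⊢
      linear_combination (norm := module) hab + hz • p.2
    · have hab := congrArg (· * p.2) (neg_comm a b)
      simp only [sub_mul, smul_mul_assoc, mul_assoc] at hab
      simp [hM2, hab])
  let F0 : ℤ → NegAlg := fun n =>
    if hn : n < 0 then neg ⟨(-n).toNat, by omega⟩ else if n = 0 then h • 1 else 0
  have hF0 : ∀ a : ℕ+, F0 (-a) = neg a := by
    intro a
    have := a.pos
    simp only [F0]
    rw [dif_pos (by omega)]
    congr 1
    apply PNat.eq
    simp
  let T : ℤ → Module.End ℂ NegAlg := fun n =>
    { toFun := fun x => (f x (F0, 1)).1 n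
      map_add' := by intro x y; simp
      map_smul' := by intro r x; simp }
  have hT : ∀ n x, T n x = (f x (F0, 1)).1 n := fun _ _ => rfl
  have hsnd : ∀ x, (f x (F0, 1)).2 = x := by
    intro x
    induction x using negAlg_induction with
    | one => simp
    | add x y hx hy => simp [hx, hy]
    | smul r x hx => simp [hx]
    | mul a x hx => simp [hf, hM2, hx]
  have hstep : ∀ n b x, T n (neg b * x)
      = neg b * T n x + ((n : ℂ) + b) • T (n - b) x + central c n (-b) • x := by
    intro n b x
    rw [hT, map_mul, hf, Module.End.mul_apply, hM1, hsnd, hT, hT]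
  have hone : ∀ n, T n 1 = F0 n := by
    intro n
    rw [hT, map_one]
    rfl
  have hneg : ∀ (a : ℕ+) x, T (-a) x = neg a * x := by
    intro a x
    induction x using negAlg_induction generalizing a with
    | one => rw [hone, hF0, mul_one]
    | add x y hx hy => rw [map_add, hx, hy, mul_add]
    | smul r x hx => rw [map_smul, hx, mul_smul_comm]
    | mul b x hx =>
      have hxb : T (-(a : ℤ) - b) x = neg (a + b) * x := by
        rw [← hx (a + b)]
        congr 2
        push_cast
        ring
      have hab := congrArg (· * x) (neg_comm a b)
      simp only [sub_mul, smul_mul_assoc, mul_assoc] at hab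
      have hz : central c (-a) (-b) = 0 := by
        have := a.pos
        have := b.pos
        exact if_neg (by omega)
      rw [hstep, hx, hxb, hz]
      push_cast
      linear_combination (norm := module) -hab
  have hmixed : ∀ (a : ℕ+) (n : ℤ) x, T n (T (-a) x) - T (-a) (T n x)
      = ((n : ℂ) + a) • T (n - a) x + central c n (-a) • x := by
    intro a n x
    rw [hneg, hneg, hstep]
    module
  have hvir : ∀ (x : NegAlg) (m n : ℤ), T m (T n x) - T n (T m x)
      = ((m : ℂ) - n) • T (m + n) x + central c m n • x := by
    intro x
    induction x using negAlg_induction with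
    | one =>
      intro m n
      rcases lt_or_ge n 0 with hn | hn
      · obtain ⟨a, rfl⟩ : ∃ a : ℕ+, n = -(a : ℤ) := ⟨⟨(-n).toNat, by omega⟩, by simp; omega⟩
        have := hmixed a m 1
        push_cast
        rw [← sub_eq_add_neg m, this]
        module
      · rcases lt_or_ge m 0 with hm | hm
        · obtain ⟨a, rfl⟩ : ∃ a : ℕ+, m = -(a : ℤ) := ⟨⟨(-m).toNat, by omega⟩, by simp; omega⟩
          have := hmixed a n 1
          push_cast
          rw [neg_add_eq_sub, central_swap c (-a) n]
          linear_combination (norm := module) -this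
        · have hz : central c m n = 0 := by
            unfold central
            split_ifs with hmn
            · obtain rfl : m = 0 := by omega
              simp
            · rfl
          have hF : ∀ k : ℤ, 0 < k → F0 k = 0 := by
            intro k hk
            simp only [F0]
            rw [dif_neg (by omega), if_neg (by omega)]
          have hF' : F0 0 = h • 1 := by simp [F0]
          rw [hz]
          rcases eq_or_lt_of_le hm with rfl | hm <;> rcases eq_or_lt_of_le hn with rfl | hn
          · simp
          · simp [hone, hF, hF', hn]
          · simp [hone, hF, hF', hm]
          · simp [hone, hF, hn, hm, hF (m + n) (by omega)]
    | add x y hx hy =>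
      intro m n
      simp only [map_add]
      linear_combination (norm := module) hx m n + hy m n
    | smul r x hx =>
      intro m n
      simp only [map_smul]
      linear_combination (norm := module) r • hx m n
    | mul b x hx =>
      intro m n
      have h1 := congrArg (neg b * ·) (hx m n)
      simp only [mul_sub, mul_add, mul_smul_comm] at h1
      have h2 := hx m (n - b)
      have h3 := hx (m - b) n
      have e1 : m + (n - (b : ℤ)) = m + n - b := by ring
      have e2 : m - (b : ℤ) + n = m + n - b := by ring
      rw [e1] at h2
      rw [e2] at h3
      have hz := central_jacobi c m n b
      simp only [hstep, map_add, map_smul]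
      push_cast at h2 h3 hz ⊢
      linear_combination (norm := module) h1 + ((n : ℂ) + b) • h2 + ((m : ℂ) + b) • h3 + hz • x
  refine ⟨T, fun m n x => hvir x m n, ?_, ?_, hneg⟩
  · intro n hn
    rw [hone]
    simp only [F0]
    rw [dif_neg (by omega), if_neg (by omega)]
  · rw [hone]
    simp [F0]

/-- The linear functional `⟨h|` on the Verma module. -/
theorem exists_bra (c h : ℂ) : ∃ ω : Module.Dual ℂ (Verma c h),
    ω (vac c h) = 1 ∧ (∀ n : ℤ, 0 < n → ∀ x, ω (vir c h (-n) x) = 0) ∧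
      ∀ x, ω (vir c h 0 x) = h * ω x := by
  obtain ⟨T, hT, hpos, h0, hneg⟩ := exists_negRep c h
  obtain ⟨p, hp1, hp⟩ := exists_vermaLift c h T hT 1 hpos h0
  obtain ⟨f, hf⟩ := exists_negLift (M := ℂ) (fun _ => 0) (by simp)
  let ω : NegAlg →ₗ[ℂ] ℂ := (LinearMap.applyₗ (1 : ℂ)).comp f.toLinearMap
  have hω1 : ω 1 = 1 := by simp [ω]
  have hω : ∀ a x, ω (neg a * x) = 0 := by simp [ω, hf]
  refine ⟨ω.comp p, by simp [hp1, hω1], ?_, ?_⟩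
  · intro n hn x
    obtain ⟨a, rfl⟩ : ∃ a : ℕ+, n = (a : ℤ) := ⟨⟨n.toNat, by omega⟩, by simp; omega⟩
    simp [hp, hneg, hω]
  · intro x
    simp only [LinearMap.comp_apply, hp]
    generalize p x = y
    induction y using negAlg_induction with
    | one => simp [h0]
    | add x y hx hy => simp [hx, hy, mul_add]
    | smul r x hx => simp [hx]; ring
    | mul b x hx =>
      have := hT 0 (-b) x
      have hz : central c 0 (-b) = 0 := by
        have := b.pos
        exact if_neg (by omega)
      rw [hneg, hneg, zero_add, hneg, hz] at this
      have := congrArg ω this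
      simp [hω] at this
      simp [hω, this]

/-- The contragredient action on the dual space. -/
theorem isVirRep_dual {M : Type} [AddCommGroup M] [Module ℂ M] {c : ℂ} {T : ℤ → Module.End ℂ M}
    (hT : IsVirRep c T) : IsVirRep (M := Module.Dual ℂ M) c (fun n => (T (-n)).dualMap) := by
  intro m n g
  ext y
  have := congrArg g (hT (-n) (-m) y)
  rw [central_neg, ← neg_add_rev] at this
  simp only [map_sub, map_add, map_smul] at this
  simp only [LinearMap.dualMap_apply, LinearMap.sub_apply, LinearMap.add_apply,
    LinearMap.smul_apply]
  rw [this]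
  push_cast
  congr 2
  ring

theorem exists_contravariantForm (c h : ℂ) : ∃ S, IsContravariantForm c h S := by
  obtain ⟨ω, hω1, hω, hω0⟩ := exists_bra c h
  obtain ⟨S, hS1, hS⟩ := exists_vermaLift c h (M := Module.Dual ℂ (Verma c h)) _
    (isVirRep_dual (isVirRep_vir c h)) ω
    (fun n hn => LinearMap.ext fun y => hω n hn y)
    (LinearMap.ext fun y => hω0 y)
  refine ⟨S, ⟨by rw [hS1, hω1], fun n x y => ?_⟩⟩
  rw [hS, LinearMap.dualMap_apply, neg_neg]

/-- The matrix elements `⟨h| φ_k y⟩`. -/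
theorem exists_braPrimary (c h Δ : ℂ) : ∃ u : ℤ → Module.Dual ℂ (Verma c h),
    u 0 (vac c h) = 1 ∧
    (∀ n : ℤ, 0 < n → ∀ k x, u k (vir c h (-n) x) = ((Δ - 1) * n + k) * u (k - n) x) ∧
    ∀ k x, u k (vir c h 0 x) = (h + k) * u k x := by
  obtain ⟨T, hT, hpos, h0, hneg⟩ := exists_negRep c h
  obtain ⟨p, hp1, hp⟩ := exists_vermaLift c h T hT 1 hpos h0
  let N : ℕ+ → Module.End ℂ (ℤ → ℂ) := fun b =>
    { toFun := fun g k => ((Δ - 1) * b + k) * g (k - b)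
      map_add' := by
        intro g g'
        ext k
        simp [mul_add]
      map_smul' := by
        intro r g
        ext k
        simp
        ring }
  have hN : ∀ b g k, N b g k = ((Δ - 1) * b + k) * g (k - b) := fun _ _ _ => rfl
  obtain ⟨f, hf⟩ := exists_negLift N (by
    intro a b g
    ext k
    have e1 : k - (b : ℤ) - a = k - a - b := by ring
    have e2 : k - ((a : ℤ) + b) = k - a - b := by ring
    simp only [Pi.sub_apply, Pi.smul_apply, hN, smul_eq_mul]
    push_cast
    rw [e1, e2]
    ring)
  let e : ℤ → ℂ := Pi.single 0 1
  let u : ℤ → Module.Dual ℂ NegAlg := fun k =>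
    { toFun := fun x => f x e k
      map_add' := by intro x y; simp
      map_smul' := by intro r x; simp }
  have hu : ∀ k x, u k x = f x e k := fun _ _ => rfl
  have hub : ∀ k b x, u k (neg b * x) = ((Δ - 1) * b + k) * u (k - b) x := by
    intro k b x
    rw [hu, map_mul, hf, Module.End.mul_apply, hN, hu]
  refine ⟨fun k => (u k).comp p, by simp [hp1, hu, e], ?_, ?_⟩
  · intro n hn k x
    obtain ⟨a, rfl⟩ : ∃ a : ℕ+, n = (a : ℤ) := ⟨⟨n.toNat, by omega⟩, by simp; omega⟩
    simp [hp, hneg, hub]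
  · intro k x
    simp only [LinearMap.comp_apply, hp]
    generalize p x = y
    induction y using negAlg_induction generalizing k with
    | one =>
      rcases eq_or_ne k 0 with rfl | hk
      · simp [h0, hu, e]
      · simp [h0, hu, e, hk]
    | add x y hx hy => simp [hx, hy, mul_add]
    | smul r x hx => simp [hx]; ring
    | mul b x hx =>
      have := hT 0 (-b) x
      have hz : central c 0 (-b) = 0 := by
        have := b.pos
        exact if_neg (by omega)
      rw [hneg, hneg, zero_add, hneg, hz, sub_eq_iff_eq_add] at this
      rw [this]
      simp only [map_add, map_smul, hub, hx, smul_eq_mul]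
      push_cast
      ring

/-- The action of the Virasoro algebra on sequences of linear functionals given by
`(L_n g)_k y = g_k (L_{-n} y) + ((1 - Δ) n - k) g_{k-n} y`. -/
theorem exists_primaryRep {M : Type} [AddCommGroup M] [Module ℂ M] {c : ℂ} (Δ : ℂ)
    {T : ℤ → Module.End ℂ M} (hT : IsVirRep c T) :
    ∃ R : ℤ → Module.End ℂ (ℤ → Module.Dual ℂ M), IsVirRep c R ∧
      ∀ n g k y, R n g k y = g k (T (-n) y) + ((1 - Δ) * n - k) * g (k - n) y := by
  let R : ℤ → Module.End ℂ (ℤ → Module.Dual ℂ M) := fun n =>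
    { toFun := fun g k => (T (-n)).dualMap (g k) + ((1 - Δ) * n - k) • g (k - n)
      map_add' := by
        intro g g'
        ext k : 1
        simp only [Pi.add_apply, map_add]
        module
      map_smul' := by
        intro r g
        ext k : 1
        simp only [Pi.smul_apply, map_smul, RingHom.id_apply]
        module }
  have hR : ∀ n g k y, R n g k y = g k (T (-n) y) + ((1 - Δ) * n - k) * g (k - n) y :=
    fun _ _ _ _ => rfl
  refine ⟨R, fun m n g => ?_, hR⟩
  ext k y
  have := congrArg (g k) (hT (-n) (-m) y)
  rw [central_neg, ← neg_add_rev] at this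
  simp only [map_sub, map_add, map_smul, smul_eq_mul] at this
  have e1 : k - n - m = k - m - n := by ring
  have e2 : k - (m + n) = k - m - n := by ring
  simp only [Pi.sub_apply, Pi.add_apply, Pi.smul_apply, LinearMap.sub_apply,
    LinearMap.add_apply, LinearMap.smul_apply, hR, smul_eq_mul, e1, e2]
  push_cast at this ⊢
  linear_combination this

theorem exists_primaryField (c h Δ : ℂ) : ∃ φ, IsPrimaryField c h Δ φ := by
  obtain ⟨u, hu1, hu, hu0⟩ := exists_braPrimary c h Δ
  obtain ⟨R, hR, hRd⟩ := exists_primaryRep Δ (isVirRep_vir c h)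
  obtain ⟨φ, hφ1, hφ⟩ := exists_vermaLift c h R hR u
    (fun n hn => funext fun k => LinearMap.ext fun y => by
      rw [hRd, hu n hn]
      simp only [Pi.zero_apply, LinearMap.zero_apply]
      ring)
    (funext fun k => LinearMap.ext fun y => by
      rw [hRd, neg_zero, hu0]
      simp only [Pi.smul_apply, LinearMap.smul_apply, smul_eq_mul, sub_zero]
      push_cast
      ring)
  refine ⟨fun k => (LinearMap.proj k).comp φ, ⟨?_, fun m k x y => ?_⟩⟩
  · rw [LinearMap.comp_apply, LinearMap.proj_apply, hφ1, hu1]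
  · simp only [LinearMap.comp_apply, LinearMap.proj_apply]
    rw [hφ, hRd, neg_neg, sub_neg_eq_add]
    push_cast
    ring

/-- The span of the words in the creation operators applied to the primary state. -/
inductive IsDescendant (c h : ℂ) : Verma c h → Prop
  | vac : IsDescendant c h (vac c h)
  | add (x y : Verma c h) : IsDescendant c h x → IsDescendant c h y → IsDescendant c h (x + y)
  | smul (r : ℂ) (x : Verma c h) : IsDescendant c h x → IsDescendant c h (r • x)
  | vir (a : ℕ+) (x : Verma c h) : IsDescendant c h x → IsDescendant c h (vir c h (-a) x)

theorem IsDescendant.vir_all {c h : ℂ} {x : Verma c h} (hx : IsDescendant c h x) (n : ℤ) :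
    IsDescendant c h (TorusBlock.vir c h n x) := by
  induction hx generalizing n with
  | vac =>
    rcases lt_trichotomy n 0 with hn | rfl | hn
    · obtain ⟨a, rfl⟩ : ∃ a : ℕ+, n = -(a : ℤ) := ⟨⟨(-n).toNat, by omega⟩, by simp; omega⟩
      exact .vir a _ .vac
    · rw [vir_vac_zero]
      exact .smul _ _ .vac
    · rw [vir_vac_pos c h hn, ← zero_smul ℂ (TorusBlock.vac c h)]
      exact .smul _ _ .vac
  | add x y _ _ hx hy =>
    rw [map_add]
    exact .add _ _ (hx n) (hy n)
  | smul r x _ hx =>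
    rw [map_smul]
    exact .smul _ _ (hx n)
  | vir a x hx' hx =>
    rw [sub_eq_iff_eq_add.1 (isVirRep_vir c h n (-a) x)]
    exact .add _ _ (.add _ _ (.smul _ _ (hx _)) (.smul _ _ hx')) (.vir a _ (hx n))

/-- The Verma module is spanned by the words in the creation operators. -/
theorem isDescendant (c h : ℂ) (x : Verma c h) : IsDescendant c h x := by
  obtain ⟨a, rfl⟩ := Submodule.Quotient.mk_surjective _ x
  obtain ⟨w, rfl⟩ := RingQuot.mkAlgHom_surjective ℂ (VirasoroRel c) a
  suffices hw : ∀ y, IsDescendant c h y →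
      IsDescendant c h (RingQuot.mkAlgHom ℂ (VirasoroRel c) w • y) by
    have := hw _ .vac
    rwa [vac, ← Submodule.Quotient.mk_smul, smul_eq_mul, mul_one] at this
  induction w using FreeAlgebra.induction with
  | grade0 r =>
    intro y hy
    rw [AlgHom.commutes, algebraMap_smul]
    exact .smul r y hy
  | grade1 n => exact fun y hy => hy.vir_all n
  | mul a b ha hb =>
    intro y hy
    rw [map_mul, mul_smul]
    exact ha _ (hb _ hy)
  | add a b ha hb =>
    intro y hy
    rw [map_add, add_smul]
    exact .add _ _ (ha _ hy) (hb _ hy)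

theorem IsContravariantForm.unique {c h : ℂ} {S S' : Verma c h →ₗ[ℂ] Verma c h →ₗ[ℂ] ℂ}
    (hS : IsContravariantForm c h S) (hS' : IsContravariantForm c h S') : S = S' := by
  have key : ∀ y, S (vac c h) y = S' (vac c h) y := by
    intro y
    induction isDescendant c h y with
    | vac => rw [hS.vac_vac, hS'.vac_vac]
    | add x y _ _ hx hy => rw [map_add, map_add, hx, hy]
    | smul r x _ hx => rw [map_smul, map_smul, hx]
    | vir a x _ _ =>
      have ha : (0 : ℤ) < a := by exact_mod_cast a.pos
      rw [← hS.adjoint, ← hS'.adjoint, neg_neg, vir_vac_pos c h ha]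
      simp only [map_zero, LinearMap.zero_apply]
  refine LinearMap.ext₂ fun x y => ?_
  induction isDescendant c h x generalizing y with
  | vac => exact key y
  | add x x' _ _ hx hy => rw [map_add, map_add, LinearMap.add_apply, LinearMap.add_apply, hx, hy]
  | smul r x _ hx => rw [map_smul, map_smul, LinearMap.smul_apply, LinearMap.smul_apply, hx]
  | vir a x _ hx => rw [hS.adjoint, hS'.adjoint, hx]

theorem IsPrimaryField.unique {c h Δ : ℂ} {φ φ' : ℤ → Verma c h →ₗ[ℂ] Verma c h →ₗ[ℂ] ℂ}
    (hφ : IsPrimaryField c h Δ φ) (hφ' : IsPrimaryField c h Δ φ') : φ = φ' := by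
  have zero : ∀ {ψ}, IsPrimaryField c h Δ ψ → ∀ k : ℤ, k ≠ 0 → ψ k (vac c h) (vac c h) = 0 := by
    intro ψ hψ k hk
    have := hψ.comm 0 k (vac c h) (vac c h)
    rw [neg_zero, vir_vac_zero, map_smul, map_smul, LinearMap.smul_apply, sub_self, add_zero] at this
    simpa [hk] using this
  have key : ∀ y k, φ k (vac c h) y = φ' k (vac c h) y := by
    intro y
    induction isDescendant c h y with
    | vac =>
      intro k
      rcases eq_or_ne k 0 with rfl | hk
      · rw [hφ.vac_vac, hφ'.vac_vac]
      · rw [zero hφ k hk, zero hφ' k hk]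
    | add x y _ _ hx hy =>
      intro k
      rw [map_add, map_add, hx, hy]
    | smul r x _ hx =>
      intro k
      rw [map_smul, map_smul, hx]
    | vir a x _ hx =>
      intro k
      have ha : (0 : ℤ) < a := by exact_mod_cast a.pos
      have h1 := hφ.comm (-a) k (vac c h) x
      have h2 := hφ'.comm (-a) k (vac c h) x
      rw [neg_neg, vir_vac_pos c h ha, map_zero, LinearMap.zero_apply, hx] at h1
      rw [neg_neg, vir_vac_pos c h ha, map_zero, LinearMap.zero_apply] at h2
      linear_combination h2 - h1
  refine funext fun k => LinearMap.ext₂ fun x y => ?_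
  induction isDescendant c h x generalizing k y with
  | vac => exact key y k
  | add x x' _ _ hx hy => rw [map_add, map_add, LinearMap.add_apply, LinearMap.add_apply, hx, hy]
  | smul r x _ hx => rw [map_smul, map_smul, LinearMap.smul_apply, LinearMap.smul_apply, hx]
  | vir a x _ hx =>
    have h1 := hφ.comm a k x y
    have h2 := hφ'.comm a k x y
    rw [hx, hx] at h1
    linear_combination h1 - h2

/-- The contravariant form `⟨x | y⟩` on the Verma module. -/
noncomputable def form (c h : ℂ) : Verma c h →ₗ[ℂ] Verma c h →ₗ[ℂ] ℂ :=
  Classical.choose (exists_contravariantForm c h)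

theorem form_spec (c h : ℂ) : IsContravariantForm c h (form c h) :=
  Classical.choose_spec (exists_contravariantForm c h)

/-- The normalised matrix elements `⟨x | φ_k | y⟩ / ⟨h | φ_0 | h⟩` of the modes of the primary
field of dimension `Δ`. -/
noncomputable def primary (c h Δ : ℂ) : ℤ → Verma c h →ₗ[ℂ] Verma c h →ₗ[ℂ] ℂ :=
  Classical.choose (exists_primaryField c h Δ)

theorem primary_spec (c h Δ : ℂ) : IsPrimaryField c h Δ (primary c h Δ) :=
  Classical.choose_spec (exists_primaryField c h Δ)

/-- The basis monomial `L_{-m_1} ⋯ L_{-m_k} |h⟩`, `m_1 ≥ ⋯ ≥ m_k ≥ 1`, labelled by the partition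
`M = (m_1, …, m_k)` of the level `n`. -/
noncomputable def descendant (c h : ℂ) {n : ℕ} (M : n.Partition) : Verma c h :=
  (M.parts.sort (· ≥ ·)).foldr (fun m x => vir c h (-(m : ℤ)) x) (vac c h)

/-- The Gram matrix `B_{M|N} = ⟨h, M | N, h⟩` at level `n`. -/
noncomputable def gram (c h : ℂ) (n : ℕ) : Matrix n.Partition n.Partition ℂ :=
  Matrix.of fun M N => form c h (descendant c h M) (descendant c h N)

/-- The matrix `⟨h, M | φ(z) | N, h⟩ / ⟨h | φ(z) | h⟩` at level `n`. Between states of equal level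
only the mode `φ_0` contributes, and the powers of `z` cancel. -/
noncomputable def primaryMatrix (Δ h c : ℂ) (n : ℕ) : Matrix n.Partition n.Partition ℂ :=
  Matrix.of fun M N => primary c h Δ 0 (descendant c h M) (descendant c h N)

/-- The coefficient `V_n(Δ, h, c)` of the one-point Virasoro torus block,
`∑_{|M| = |N| = n} B^{M|N} ⟨h, M | φ(z) | N, h⟩ / ⟨h | φ(z) | h⟩`, where `B^{M|N}` is the inverse
of the Gram matrix. -/
noncomputable def virasoroCoeff (Δ h c : ℂ) (n : ℕ) : ℂ :=
  ∑ M : n.Partition, ∑ N : n.Partition, (gram c h n)⁻¹ M N * primaryMatrix Δ h c n M N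

/-- `L` is the light block: the `c → ∞` limit at fixed `Δ` and `h`, with an error `O(1/c)`, of the
power series `∑ V_n(Δ, h, c) q^n`, coefficient by coefficient. -/
def IsLightBlock (Δ h : ℂ) (L : PowerSeries ℂ) : Prop :=
  ∀ n : ℕ, (fun c : ℂ => virasoroCoeff Δ h c n - PowerSeries.coeff n L)
    =O[Bornology.cobounded ℂ] fun c : ℂ => c⁻¹

/-- The state `L_{-1}^n |h⟩`. -/
noncomputable def slState (c h : ℂ) (n : ℕ) : Verma c h := (vir c h (-1) ^ n) (vac c h)

/-- The coefficient
`F_n(Δ, h) = ⟨h | L_1^n φ(z) L_{-1}^n | h⟩ / (⟨h | φ(z) | h⟩ ⟨h | L_1^n L_{-1}^n | h⟩)`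
of the global torus block. It only involves the `sl(2)` subalgebra spanned by `L_0`, `L_1`,
`L_{-1}` of the Virasoro algebra of central charge `c`. -/
noncomputable def globalCoeff (Δ h c : ℂ) (n : ℕ) : ℂ :=
  primary c h Δ 0 (slState c h n) (slState c h n) / form c h (slState c h n) (slState c h n)

/-- The global torus block `∑ F_n(Δ, h) q^n`. -/
noncomputable def globalBlock (Δ h c : ℂ) : PowerSeries ℂ :=
  PowerSeries.mk (globalCoeff Δ h c)

open scoped PowerSeries.WithPiTopology in
/-- The Euler function `∏_{n ≥ 1} (1 - q^n)` as a formal power series. -/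
noncomputable def eulerFunction : PowerSeries ℂ :=
  ∏' n : ℕ, (1 - PowerSeries.X ^ (n + 1))

/-- The number of partitions of `m` with no part equal to `1`. -/
def cardNoOnes (m : ℕ) : ℕ := (Nat.Partition.restricted m (fun i => i ≠ 1)).card

end TorusBlock

/-! ### Limits and leading coefficients as c → ∞, with error O(1/c) -/

namespace TorusBlock

open Filter Bornology Asymptotics

/-! Write a partition `M` as its parts ≥ 2, the word `l` of length `r(M)`, followed by `j` ones. The
proof counts powers of c. A power of c arises only when `L_m` is contracted with `L_{-m}`, and never
with `L_{-1}`, because `m (m² - 1)` vanishes at `m = 1`. Commuting a mode through φ costs no power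
of c. Hence `⟨M|φ|N⟩` is O(c^min(r(M), r(N))) (`IsWordFamily.exists_hasLead` and its mirror image).

For words of equal length the top power needs every letter of one word contracted with an equal
letter of the other. `hasLead_wordState` therefore gives zero unless the words are permutations of
each other, and otherwise a combinatorial factor `wordNorm l`, independent of Δ, times an sl(2)
matrix element of the states `L_{-1}^j |h⟩`. At a fixed level the word determines `M`.

Divide row `M` of both the Gram matrix B and the matrix P of φ by c^r(M); this leaves `B⁻¹ P`
unchanged. The limiting matrices are diagonal on blocks of equal `r` and vanish below them, so the
trace of `B⁻¹ P` tends to the sum of the ratios of diagonal entries (`hasLimit_trace_inv_mul`). In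
each ratio `wordNorm l` cancels and `F_j` remains. Grouping partitions by their number of ones gives
`∑ p_1(n-k) F_k` (`sum_count_one`), and `∑ p_1(m) q^m = (1-q)/φ(q)` (`mk_cardNoOnes_eq`).

The Gram matrix needs no separate analysis: the contravariant form is the zero mode of the primary
field with Δ = 0 (`form_eq_primary`). -/

/-- `f c = a + O(1 / c)` as `c → ∞`. -/
def HasLimit (f : ℂ → ℂ) (a : ℂ) : Prop :=
  (fun c => f c - a) =O[cobounded ℂ] fun c : ℂ => c⁻¹

theorem eventually_ne_zero_cobounded : ∀ᶠ c : ℂ in cobounded ℂ, c ≠ 0 :=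
  eventually_ne_cobounded 0

namespace HasLimit

variable {f g : ℂ → ℂ} {a b : ℂ}

theorem const (a : ℂ) : HasLimit (fun _ => a) a := by
  simpa [HasLimit] using isBigO_zero _ _

theorem congr' (hf : HasLimit f a) (h : f =ᶠ[cobounded ℂ] g) : HasLimit g a :=
  IsBigO.congr' hf (h.mono fun c hc => by simp only [hc]) (EventuallyEq.refl _ _)

theorem tendsto (hf : HasLimit f a) : Tendsto f (cobounded ℂ) (nhds a) := by
  have := (IsBigO.trans_tendsto hf (tendsto_inv₀_cobounded (α := ℂ))).add_const a
  simpa using this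

theorem isBigO_one (hf : HasLimit f a) : f =O[cobounded ℂ] fun _ => (1 : ℂ) :=
  hf.tendsto.isBigO_one ℂ

theorem unique (hf : HasLimit f a) (hf' : HasLimit f b) : a = b :=
  tendsto_nhds_unique hf.tendsto hf'.tendsto

theorem add (hf : HasLimit f a) (hg : HasLimit g b) : HasLimit (fun c => f c + g c) (a + b) :=
  (IsBigO.add hf hg).congr_left fun c => by ring

theorem mul (hf : HasLimit f a) (hg : HasLimit g b) : HasLimit (fun c => f c * g c) (a * b) := by
  have h1 : (fun c => (f c - a) * g c) =O[cobounded ℂ] fun c : ℂ => c⁻¹ := by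
    simpa using IsBigO.mul hf hg.isBigO_one
  exact (h1.add (IsBigO.const_mul_left hg a)).congr_left fun c => by ring

theorem const_mul (r : ℂ) (hf : HasLimit f a) : HasLimit (fun c => r * f c) (r * a) :=
  (const r).mul hf

theorem inv (hf : HasLimit f a) (ha : a ≠ 0) : HasLimit (fun c => (f c)⁻¹) a⁻¹ := by
  have h1 : (fun c => (f c)⁻¹) =O[cobounded ℂ] fun _ => (1 : ℂ) :=
    (hf.tendsto.inv₀ ha).isBigO_one ℂ
  -- Uses f⁻¹ - a⁻¹ = -a⁻¹ f⁻¹ (f - a), so boundedness of f⁻¹ preserves the error O(1/c).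
  have h2 : (fun c => (-a⁻¹ * (f c)⁻¹) * (f c - a)) =O[cobounded ℂ] fun c : ℂ => c⁻¹ := by
    simpa using (h1.const_mul_left (-a⁻¹)).mul hf
  refine h2.congr' ?_ (EventuallyEq.refl _ _)
  filter_upwards [hf.tendsto.eventually_ne ha] with c hc
  field_simp
  ring

theorem sum {ι : Type*} (s : Finset ι) {f : ι → ℂ → ℂ} {a : ι → ℂ}
    (hf : ∀ i ∈ s, HasLimit (f i) (a i)) : HasLimit (fun c => ∑ i ∈ s, f i c) (∑ i ∈ s, a i) := by
  classical
  induction s using Finset.induction_on with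
  | empty => simpa using const 0
  | insert i s hi ih =>
    simp only [Finset.sum_insert hi]
    exact (hf i (by simp)).add (ih fun j hj => hf j (by simp [hj]))

theorem prod {ι : Type*} (s : Finset ι) {f : ι → ℂ → ℂ} {a : ι → ℂ}
    (hf : ∀ i ∈ s, HasLimit (f i) (a i)) : HasLimit (fun c => ∏ i ∈ s, f i c) (∏ i ∈ s, a i) := by
  classical
  induction s using Finset.induction_on with
  | empty => simpa using const 1
  | insert i s hi ih =>
    simp only [Finset.prod_insert hi]
    exact (hf i (by simp)).mul (ih fun j hj => hf j (by simp [hj]))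

theorem det {ι : Type*} [Fintype ι] [DecidableEq ι] {A : ℂ → Matrix ι ι ℂ} {a : Matrix ι ι ℂ}
    (hA : ∀ i j, HasLimit (fun c => A c i j) (a i j)) : HasLimit (fun c => (A c).det) a.det := by
  simp only [Matrix.det_apply']
  exact sum _ fun σ _ => (prod _ fun i _ => hA _ _).const_mul _

/-- Cramer's rule: each entry of the inverse is a minor over the determinant. -/
theorem matrix_inv {ι : Type*} [Fintype ι] [DecidableEq ι] {A : ℂ → Matrix ι ι ℂ}
    {a : Matrix ι ι ℂ} (hA : ∀ i j, HasLimit (fun c => A c i j) (a i j)) (ha : a.det ≠ 0)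
    (i j : ι) : HasLimit (fun c => (A c)⁻¹ i j) (a⁻¹ i j) := by
  simp only [Matrix.inv_def, Ring.inverse_eq_inv', Matrix.smul_apply, smul_eq_mul,
    Matrix.adjugate_apply]
  refine ((det hA).inv ha).mul (det fun k l => ?_)
  simp only [Matrix.updateRow_apply]
  split_ifs
  · exact const _
  · exact hA k l

end HasLimit

/-- `f c = a c ^ d + O(c ^ (d - 1))` as `c → ∞`. -/
def HasLead (d : ℕ) (f : ℂ → ℂ) (a : ℂ) : Prop := HasLimit (fun c => f c / c ^ d) a

namespace HasLead

variable {d : ℕ} {f g : ℂ → ℂ} {a b : ℂ}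

theorem const (a : ℂ) : HasLead 0 (fun _ => a) a := by
  simpa [HasLead] using HasLimit.const a

theorem add (hf : HasLead d f a) (hg : HasLead d g b) :
    HasLead d (fun c => f c + g c) (a + b) := by
  simpa only [HasLead, add_div] using HasLimit.add hf hg

theorem const_mul (r : ℂ) (hf : HasLead d f a) : HasLead d (fun c => r * f c) (r * a) := by
  simpa only [HasLead, mul_div_assoc] using HasLimit.const_mul r hf

theorem zero (d : ℕ) : HasLead d (fun _ => 0) 0 := by
  simpa [HasLead] using HasLimit.const 0

theorem id_mul (hf : HasLead d f a) : HasLead (d + 1) (fun c => c * f c) a := by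
  refine HasLimit.congr' hf ?_
  filter_upwards [eventually_ne_zero_cobounded] with c hc
  rw [pow_succ]
  field_simp

/-- Read in a higher degree, a function loses its leading coefficient; lower-order terms are
discarded this way. -/
theorem succ (hf : HasLead d f a) : HasLead (d + 1) f 0 := by
  have h : HasLimit (fun c : ℂ => c⁻¹) 0 := by simpa [HasLimit] using isBigO_refl _ _
  have := HasLimit.mul h hf
  rw [zero_mul] at this
  refine this.congr' ?_
  filter_upwards [eventually_ne_zero_cobounded] with c hc
  rw [pow_succ]
  field_simp

theorem of_lt {e : ℕ} (hf : HasLead d f a) (h : d < e) : HasLead e f 0 := by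
  induction e, h using Nat.le_induction with
  | base => exact hf.succ
  | succ e _ ih => exact ih.succ

end HasLead

/-! ### Strictly block triangular matrices and the trace of `B⁻¹ P` -/

section Matrix

variable {ι : Type*} [Fintype ι] [DecidableEq ι] {r : ι → ℕ} {b p : Matrix ι ι ℂ}

/-- The matrix is block triangular with respect to `r`, and within a block of equal `r` the
hypothesis also covers the off-diagonal entries, so each diagonal block is diagonal. -/
theorem det_ne_zero_of_strict (hb : ∀ i j, i ≠ j → r j ≤ r i → b i j = 0)
    (hd : ∀ i, b i i ≠ 0) : b.det ≠ 0 := by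
  have ht : b.BlockTriangular r := fun i j hij =>
    hb i j (by rintro rfl; exact lt_irrefl _ hij) hij.le
  rw [ht.det]
  refine Finset.prod_ne_zero_iff.2 fun k _ => ?_
  have : b.toSquareBlock r k = Matrix.diagonal fun i : {i // r i = k} => b i i := by
    ext i j
    rw [Matrix.toSquareBlock_def, Matrix.of_apply, Matrix.diagonal_apply]
    split_ifs with hij
    · rw [hij]
    · exact hb i j (fun h => hij (Subtype.ext h)) (by rw [i.2, j.2])
  rw [this, Matrix.det_diagonal]
  exact Finset.prod_ne_zero_iff.2 fun i _ => hd i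

theorem trace_inv_mul_of_strict (hb : ∀ i j, i ≠ j → r j ≤ r i → b i j = 0)
    (hp : ∀ i j, i ≠ j → r j ≤ r i → p i j = 0) (hd : ∀ i, b i i ≠ 0) :
    (b⁻¹ * p).trace = ∑ i, p i i / b i i := by
  have hdet := det_ne_zero_of_strict hb hd
  have ht : b.BlockTriangular r := fun i j hij =>
    hb i j (by rintro rfl; exact lt_irrefl _ hij) hij.le
  have hunit : IsUnit b.det := isUnit_iff_ne_zero.2 hdet
  let := b.invertibleOfIsUnitDet hunit
  have hinv := Matrix.blockTriangular_inv_of_blockTriangular ht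
  -- Subtracting `diagonal q * b` from `p` also clears the diagonal. The remainder is supported on
  -- `r i < r j`, exactly where the transposed entry of `b⁻¹` vanishes, so it contributes nothing to
  -- the trace.
  let q : ι → ℂ := fun i => p i i / b i i
  have hs : ∀ i j, r j ≤ r i → (p - Matrix.diagonal q * b) i j = 0 := by
    intro i j hij
    rw [Matrix.sub_apply, Matrix.diagonal_mul]
    rcases eq_or_ne i j with rfl | h
    · simp only [q]
      rw [div_mul_cancel₀ _ (hd i), sub_self]
    · rw [hb i j h hij, hp i j h hij]
      simp
  have hz : ((p - Matrix.diagonal q * b) * b⁻¹).trace = 0 := by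
    rw [Matrix.trace]
    refine Finset.sum_eq_zero fun i _ => ?_
    rw [Matrix.diag_apply, Matrix.mul_apply]
    refine Finset.sum_eq_zero fun j _ => ?_
    rcases le_or_gt (r j) (r i) with h | h
    · rw [hs i j h, zero_mul]
    · rw [hinv h, mul_zero]
  rw [sub_mul, mul_assoc, Matrix.mul_nonsing_inv _ hunit, mul_one, Matrix.trace_sub,
    Matrix.trace_diagonal, sub_eq_zero] at hz
  rw [Matrix.trace_mul_comm, hz]

/-- If the row `i` of `B` and `P` is `O(c ^ r i)` and the matrices of leading coefficients are
strictly triangular off the diagonal, then the trace of `B⁻¹ P` has a limit. -/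
theorem hasLimit_trace_inv_mul {B P : ℂ → Matrix ι ι ℂ}
    (hB : ∀ i j, HasLead (r i) (fun c => B c i j) (b i j))
    (hP : ∀ i j, HasLead (r i) (fun c => P c i j) (p i j))
    (hb : ∀ i j, i ≠ j → r j ≤ r i → b i j = 0)
    (hp : ∀ i j, i ≠ j → r j ≤ r i → p i j = 0) (hd : ∀ i, b i i ≠ 0) :
    (∀ᶠ c in cobounded ℂ, IsUnit (B c).det) ∧
      HasLimit (fun c => ((B c)⁻¹ * P c).trace) (∑ i, p i i / b i i) := by
  -- Only rows are rescaled. The same left factor on `B` and `P` cancels in `B⁻¹ P`.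
  let D : ℂ → Matrix ι ι ℂ := fun c => Matrix.diagonal fun i => (c ^ r i)⁻¹
  have hD : ∀ c ≠ 0, IsUnit (D c).det := by
    intro c hc
    rw [Matrix.det_diagonal, isUnit_iff_ne_zero]
    exact Finset.prod_ne_zero_iff.2 fun i _ => inv_ne_zero (pow_ne_zero _ hc)
  have hB' : ∀ i j, HasLimit (fun c => (D c * B c) i j) (b i j) := by
    intro i j
    refine (hB i j).congr' (Eventually.of_forall fun c => ?_)
    simp only [D, Matrix.diagonal_mul]
    rw [div_eq_inv_mul]
  have hP' : ∀ i j, HasLimit (fun c => (D c * P c) i j) (p i j) := by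
    intro i j
    refine (hP i j).congr' (Eventually.of_forall fun c => ?_)
    simp only [D, Matrix.diagonal_mul]
    rw [div_eq_inv_mul]
  have hdet := det_ne_zero_of_strict hb hd
  constructor
  · filter_upwards [(HasLimit.det hB').tendsto.eventually_ne hdet] with c hc
    rw [Matrix.det_mul] at hc
    exact isUnit_iff_ne_zero.2 (right_ne_zero_of_mul hc)
  · have hlim : HasLimit (fun c => ((D c * B c)⁻¹ * (D c * P c)).trace) ((b⁻¹ * p).trace) := by
      simp only [Matrix.trace, Matrix.diag_apply, Matrix.mul_apply (M := _⁻¹)]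
      exact HasLimit.sum _ fun i _ => HasLimit.sum _ fun j _ =>
        (HasLimit.matrix_inv hB' hdet i j).mul (hP' j i)
    rw [trace_inv_mul_of_strict hb hp hd] at hlim
    refine hlim.congr' ?_
    filter_upwards [eventually_ne_zero_cobounded] with c hc
    rw [Matrix.mul_inv_rev, mul_assoc, ← mul_assoc (D c)⁻¹, Matrix.nonsing_inv_mul _ (hD c hc),
      one_mul]

end Matrix

/-! ### Partitions without ones and the Euler function -/

section Partitions

open PowerSeries

theorem mk_cardNoOnes_mul_eulerFunction :
    (PowerSeries.mk fun n => (cardNoOnes n : ℂ)) * eulerFunction = 1 - X := by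
  open scoped PowerSeries.WithPiTopology in
  have h1 := Nat.Partition.hasProd_powerSeriesMk_card_restricted ℂ (fun i => i ≠ 1)
  have h2 : Multipliable fun n : ℕ => (1 - X ^ (n + 1) : ℂ⟦X⟧) :=
    WithPiTopology.multipliable_one_sub_X_pow ℂ
  have h3 := h1.mul h2.hasProd
  have h4 : HasProd (fun i : ℕ => (if i + 1 ≠ 1 then ∑' j : ℕ, (X : ℂ⟦X⟧) ^ ((i + 1) * j) else 1)
      * (1 - X ^ (i + 1))) (1 - X) := by
    have : (1 - X : ℂ⟦X⟧) = (fun i : ℕ => (if i + 1 ≠ 1 then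
      ∑' j : ℕ, (X : ℂ⟦X⟧) ^ ((i + 1) * j) else 1) * (1 - X ^ (i + 1))) 0 := by simp
    -- The factors with `i > 0` are geometric series times their inverses; only `i = 0`, the missing
    -- part 1, survives.
    rw [this]
    refine hasProd_single 0 fun i hi => ?_
    have hc : constantCoeff (X ^ (i + 1) : ℂ⟦X⟧) = 0 := by simp
    rw [if_pos (by omega)]
    simp only [pow_mul]
    exact WithPiTopology.tsum_pow_mul_one_sub_of_constantCoeff_eq_zero hc
  exact h3.unique h4

theorem mk_cardNoOnes_eq :
    (PowerSeries.mk fun n => (cardNoOnes n : ℂ)) = (1 - X) * eulerFunction⁻¹ := by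
  have h := mk_cardNoOnes_mul_eulerFunction
  -- The inverse of a power series over a field is genuine only for nonzero constant coefficient;
  -- here the product formula forces it.
  have hc : constantCoeff eulerFunction ≠ 0 := by
    intro h0
    have := congrArg (constantCoeff (R := ℂ)) h
    simp [h0] at this
  rw [PowerSeries.eq_mul_inv_iff_mul_eq hc, h]

theorem filter_add_replicate_count_one (s : Multiset ℕ) :
    s.filter (· ≠ 1) + Multiset.replicate (s.count 1) 1 = s := by
  rw [← Multiset.filter_eq', add_comm]
  exact Multiset.filter_add_not _ _

theorem sum_filter_add_count_one {n : ℕ} (M : n.Partition) :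
    (M.parts.filter (· ≠ 1)).sum + M.parts.count 1 = n := by
  have := congrArg Multiset.sum (filter_add_replicate_count_one M.parts)
  rwa [M.parts_sum, Multiset.sum_add, Multiset.sum_replicate, smul_eq_mul, mul_one] at this

/-- Adjoining `k` ones is a bijection from the partitions of `n - k` without ones; its inverse drops
the ones. -/
theorem card_count_one_eq {n k : ℕ} (hk : k ≤ n) :
    (Finset.univ.filter fun M : n.Partition => M.parts.count 1 = k).card = cardNoOnes (n - k) := by
  symm
  refine Finset.card_bij (fun N _ => ⟨N.parts + Multiset.replicate k 1, ?_, ?_⟩) ?_ ?_ ?_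
  · intro i hi
    rcases Multiset.mem_add.1 hi with hi | hi
    · exact N.parts_pos hi
    · rw [Multiset.eq_of_mem_replicate hi]
      exact one_pos
  · rw [Multiset.sum_add, N.parts_sum, Multiset.sum_replicate, smul_eq_mul, mul_one]
    omega
  · intro N hN
    rw [Nat.Partition.restricted, Finset.mem_filter] at hN
    have : N.parts.count 1 = 0 := Multiset.count_eq_zero.2 fun h => hN.2 1 h rfl
    simp [this]
  · intro N _ N' _ h
    exact Nat.Partition.ext (add_right_cancel (congrArg Nat.Partition.parts h))
  · intro M hM
    have hM : M.parts.count 1 = k := by simpa using hM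
    refine ⟨⟨M.parts.filter (· ≠ 1), fun hi => M.parts_pos (Multiset.mem_of_mem_filter hi), ?_⟩,
      ?_, ?_⟩
    · have := sum_filter_add_count_one M
      omega
    · simp [Nat.Partition.restricted]
    · refine Nat.Partition.ext ?_
      simp only
      rw [← hM, filter_add_replicate_count_one]

theorem sum_count_one {n : ℕ} (F : ℕ → ℂ) :
    ∑ M : n.Partition, F (M.parts.count 1)
      = ∑ k ∈ Finset.range (n + 1), (cardNoOnes (n - k) : ℂ) * F k := by
  rw [← Finset.sum_fiberwise_of_maps_to (t := Finset.range (n + 1))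
    (g := fun M : n.Partition => M.parts.count 1)
    (fun M _ => Finset.mem_range.2 (by have := sum_filter_add_count_one M; omega))]
  refine Finset.sum_congr rfl fun k hk => ?_
  rw [← card_count_one_eq (Nat.lt_succ_iff.1 (Finset.mem_range.1 hk)), ← nsmul_eq_mul]
  exact Finset.sum_eq_card_nsmul fun M hM => by rw [(Finset.mem_filter.1 hM).2]

end Partitions

end TorusBlock

/-! ### Matrix elements of the primary field -/

namespace TorusBlock

variable {h Δ : ℂ}

theorem central_eq_mul (c : ℂ) (m n : ℤ) : central c m n = c * central 1 m n := by
  unfold central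
  split_ifs <;> ring

theorem zero_smul_verma {c : ℂ} (x : Verma c h) : (0 : ℂ) • x = 0 := zero_smul ℂ x

theorem smul_zero_verma (c r : ℂ) : r • (0 : Verma c h) = 0 :=
  smul_zero (M := ℂ) (A := Verma c h) r

theorem central_smul {c : ℂ} (m n : ℤ) (x : Verma c h) :
    central c m n • x = central 1 m n • c • x := by
  rw [central_eq_mul, mul_comm]
  exact mul_smul (central 1 m n) c x

/-- This is why `L_{-1}` carries no weight in the power counting: at `m = 1` the factor `m² - 1` is
zero. -/
theorem central_neg_one (c : ℂ) {m : ℤ} (hm : 0 ≤ m) : central c m (-1) = 0 := by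
  unfold central
  split_ifs with h1
  · obtain rfl : m = 1 := by omega
    norm_num
  · rfl

/-- `L_m L_{-n} x = L_{-n} L_m x + (m + n) L_{m-n} x + (c/12) m (m^2 - 1) δ_{m,n} x`. -/
theorem vir_vir_neg (c h : ℂ) (m n : ℤ) (x : Verma c h) :
    vir c h m (vir c h (-n) x) = vir c h (-n) (vir c h m x)
      + (((m : ℂ) + n) • vir c h (m - n) x + central c m (-n) • x) := by
  rw [sub_eq_iff_eq_add'.1 (isVirRep_vir c h m (-n) x), ← sub_eq_add_neg m]
  push_cast
  rw [sub_neg_eq_add]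

theorem primary_vir_left (c h Δ : ℂ) (k m : ℤ) (x y : Verma c h) :
    primary c h Δ k (vir c h (-m) x) y = primary c h Δ k x (vir c h m y)
      + ((Δ - 1) * m - k) * primary c h Δ (k + m) x y :=
  sub_eq_iff_eq_add'.1 ((primary_spec c h Δ).comm m k x y)

/-- The transposed field with modes reversed satisfies the same covariance law and normalisation, so
uniqueness applies. -/
theorem primary_symm (c h Δ : ℂ) (k : ℤ) (x y : Verma c h) :
    primary c h Δ k x y = primary c h Δ (-k) y x := by
  have : IsPrimaryField c h Δ fun k => (primary c h Δ (-k)).flip := by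
    refine ⟨by simpa using (primary_spec c h Δ).vac_vac, fun m k x y => ?_⟩
    have := (primary_spec c h Δ).comm (-m) (-k) y x
    simp only [LinearMap.flip_apply]
    rw [neg_neg] at this
    rw [neg_add]
    push_cast at this
    linear_combination -this
  exact congrFun (congrArg DFunLike.coe (congrFun (congrArg DFunLike.coe
    (congrFun ((primary_spec c h Δ).unique this) k)) x)) y

/-- At Δ = 0 the identity operator is a primary field: its only mode is `k = 0`, and the coefficient
`-m - k` vanishes whenever `k + m = 0`. Uniqueness identifies the two. -/
theorem form_eq_primary (c h : ℂ) : form c h = primary c h 0 0 := by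
  have : IsPrimaryField c h 0 (Pi.single 0 (form c h)) := by
    refine ⟨by simpa using (form_spec c h).vac_vac, fun m k x y => ?_⟩
    rcases eq_or_ne k 0 with rfl | hk
    · rcases eq_or_ne m 0 with rfl | hm
      · simp [← (form_spec c h).adjoint 0]
      · simp [(form_spec c h).adjoint, hm]
    · rcases eq_or_ne (k + m) 0 with hm | hm
      · obtain rfl : k = -m := by omega
        simp [hk]
      · simp [hk, hm]
  have := congrFun ((primary_spec c h 0).unique this) 0
  rw [this, Pi.single_eq_same]

theorem primary_vac_vac (c h Δ : ℂ) (k : ℤ) :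
    primary c h Δ k (vac c h) (vac c h) = if k = 0 then 1 else 0 := by
  split_ifs with hk
  · rw [hk, (primary_spec c h Δ).vac_vac]
  · have := (primary_spec c h Δ).comm 0 k (vac c h) (vac c h)
    rw [neg_zero, vir_vac_zero, map_smul, map_smul, LinearMap.smul_apply, sub_self,
      add_zero] at this
    simpa [hk] using this

theorem primary_vac_vir_neg (c h Δ : ℂ) (k : ℤ) {n : ℤ} (hn : 0 < n) (y : Verma c h) :
    primary c h Δ k (vac c h) (vir c h (-n) y)
      = ((Δ - 1) * n + k) * primary c h Δ (k - n) (vac c h) y := by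
  have := primary_vir_left c h Δ k (-n) (vac c h) y
  rw [neg_neg, vir_vac_pos c h hn, map_zero, LinearMap.zero_apply, ← sub_eq_add_neg] at this
  push_cast at this
  linear_combination -this

/-! ### Counting powers of the central charge -/

/-- Families of vectors, one in the Verma module of each central charge, spanned by words in the
creation operators with coefficients independent of the central charge. -/
inductive IsWordFamily (h : ℂ) : (∀ c, Verma c h) → Prop
  | vac : IsWordFamily h fun c => vac c h
  | vir {n : ℤ} {v : ∀ c, Verma c h} (hn : 0 < n) : IsWordFamily h v →
      IsWordFamily h fun c => vir c h (-n) (v c)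
  | add {v w : ∀ c, Verma c h} : IsWordFamily h v → IsWordFamily h w →
      IsWordFamily h fun c => v c + w c
  | smul {v : ∀ c, Verma c h} (r : ℂ) : IsWordFamily h v → IsWordFamily h fun c => r • v c

/-- Families of vectors spanned by products of powers of the central charge and words in the
creation operators, such that the power plus the number of letters `L_{-m}`, `m ≥ 2`, is at
most `d`. -/
inductive HasWeight (h : ℂ) : ℕ → (∀ c, Verma c h) → Prop
  | vac : HasWeight h 0 fun c => vac c h
  | vir_neg_one {d : ℕ} {v : ∀ c, Verma c h} : HasWeight h d v →
      HasWeight h d fun c => vir c h (-1) (v c)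
  | vir {d : ℕ} {n : ℤ} {v : ∀ c, Verma c h} (hn : 0 < n) : HasWeight h d v →
      HasWeight h (d + 1) fun c => vir c h (-n) (v c)
  | charge {d : ℕ} {v : ∀ c, Verma c h} : HasWeight h d v → HasWeight h (d + 1) fun c => c • v c
  | add {d : ℕ} {v w : ∀ c, Verma c h} : HasWeight h d v → HasWeight h d w →
      HasWeight h d fun c => v c + w c
  | smul {d : ℕ} {v : ∀ c, Verma c h} (r : ℂ) : HasWeight h d v → HasWeight h d fun c => r • v c
  | succ {d : ℕ} {v : ∀ c, Verma c h} : HasWeight h d v → HasWeight h (d + 1) v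

theorem IsWordFamily.zero : IsWordFamily h fun _ => 0 := by
  simpa only [zero_smul_verma] using IsWordFamily.vac.smul (h := h) 0

theorem HasWeight.zero (d : ℕ) : HasWeight h d fun _ => 0 := by
  induction d with
  | zero => simpa only [zero_smul_verma] using HasWeight.vac.smul (h := h) 0
  | succ d ih => exact ih.succ

/-- The annihilation operators and `L_0` do not raise the weight. -/
theorem HasWeight.vir_nonneg {d : ℕ} {v : ∀ c, Verma c h} (hv : HasWeight h d v) {m : ℤ}
    (hm : 0 ≤ m) : HasWeight h d fun c => TorusBlock.vir c h m (v c) := by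
  induction hv generalizing m with
  | vac =>
    rcases hm.eq_or_lt with rfl | hm
    · simp only [vir_vac_zero]
      exact HasWeight.vac.smul h
    · simp only [vir_vac_pos _ h hm]
      exact HasWeight.zero 0
  | @vir_neg_one d v hv ih =>
    simp only [vir_vir_neg _ h m 1, central_neg_one _ hm]
    refine (ih hm).vir_neg_one.add (.add (.smul _ ?_) ?_)
    · rcases hm.eq_or_lt with rfl | hm
      · exact hv.vir_neg_one
      · exact ih (by omega)
    · simpa only [zero_smul_verma] using HasWeight.zero d
  | @vir d n v hn hv ih =>
    simp only [vir_vir_neg _ h m n]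
    refine ((ih hm).vir hn).add (.add (.smul _ ?_) ?_)
    -- `L_{m-n}` either annihilates or preserves the level, at no cost, or creates, replacing the
    -- letter `L_{-n}` by another one. The central term trades that letter for one factor c.
    · rcases le_or_gt n m with hmn | hmn
      · exact (ih (sub_nonneg.2 hmn)).succ
      · rw [← neg_sub]
        exact hv.vir (sub_pos.2 hmn)
    · simp only [central_smul]
      exact hv.charge.smul _
  | charge _ ih => simpa only [map_smul] using (ih hm).charge
  | add _ _ ih ih' => simpa only [map_add] using (ih hm).add (ih' hm)
  | smul r _ ih => simpa only [map_smul] using (ih hm).smul r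
  | succ _ ih => exact (ih hm).succ

/-- Against `⟨h|` each creation operator is absorbed into φ with a scalar free of c, so only the
explicit powers of c count. -/
theorem HasWeight.exists_hasLead_vac {d : ℕ} {v : ∀ c, Verma c h} (hv : HasWeight h d v) (Δ : ℂ)
    (k : ℤ) : ∃ a, HasLead d (fun c => primary c h Δ k (TorusBlock.vac c h) (v c)) a := by
  induction hv generalizing k with
  | vac =>
    simp only [primary_vac_vac]
    exact ⟨_, HasLead.const _⟩
  | vir_neg_one _ ih =>
    obtain ⟨a, ha⟩ := ih (k - 1)
    simp only [primary_vac_vir_neg _ h Δ k one_pos]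
    exact ⟨_, ha.const_mul _⟩
  | @vir d n v hn _ ih =>
    obtain ⟨a, ha⟩ := ih (k - n)
    simp only [primary_vac_vir_neg _ h Δ k hn]
    exact ⟨_, ha.succ.const_mul _⟩
  | charge _ ih =>
    obtain ⟨a, ha⟩ := ih k
    simp only [map_smul, smul_eq_mul]
    exact ⟨_, ha.id_mul⟩
  | add _ _ ih ih' =>
    obtain ⟨a, ha⟩ := ih k
    obtain ⟨b, hb⟩ := ih' k
    simp only [map_add]
    exact ⟨_, ha.add hb⟩
  | smul r _ ih =>
    obtain ⟨a, ha⟩ := ih k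
    simp only [map_smul, smul_eq_mul]
    exact ⟨_, ha.const_mul r⟩
  | succ _ ih =>
    obtain ⟨a, ha⟩ := ih k
    exact ⟨_, ha.succ⟩

/-- The matrix elements of a family of weight `d` with a word are `O(c ^ d)`. -/
theorem IsWordFamily.exists_hasLead {u v : ∀ c, Verma c h} {d : ℕ} (hu : IsWordFamily h u)
    (hv : HasWeight h d v) (Δ : ℂ) (k : ℤ) :
    ∃ a, HasLead d (fun c => primary c h Δ k (u c) (v c)) a := by
  induction hu generalizing k v with
  | vac => exact hv.exists_hasLead_vac Δ k
  | @vir n u hn _ ih =>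
    -- The letter moved off the bra acts on `v` as an annihilation operator, which keeps the weight,
    -- or shifts the mode of φ.
    obtain ⟨a, ha⟩ := ih (hv.vir_nonneg hn.le) k
    obtain ⟨b, hb⟩ := ih hv (k + n)
    simp only [primary_vir_left]
    exact ⟨_, ha.add (hb.const_mul _)⟩
  | add _ _ ih ih' =>
    obtain ⟨a, ha⟩ := ih hv k
    obtain ⟨b, hb⟩ := ih' hv k
    simp only [map_add, LinearMap.add_apply]
    exact ⟨_, ha.add hb⟩
  | smul r _ ih =>
    obtain ⟨a, ha⟩ := ih hv k
    simp only [map_smul, LinearMap.smul_apply, smul_eq_mul]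
    exact ⟨_, ha.const_mul r⟩

theorem IsWordFamily.exists_hasLead_symm {u v : ∀ c, Verma c h} {d : ℕ} (hu : IsWordFamily h u)
    (hv : HasWeight h d v) (Δ : ℂ) (k : ℤ) :
    ∃ a, HasLead d (fun c => primary c h Δ k (v c) (u c)) a := by
  simp only [primary_symm _ h Δ k]
  exact hu.exists_hasLead hv Δ (-k)

/-- The families whose matrix elements with words of weight less than `d` are `O(c ^ (d - 1))`. -/
inductive IsSmall (h : ℂ) (d : ℕ) : (∀ c, Verma c h) → Prop
  | word {v : ∀ c, Verma c h} : IsWordFamily h v → IsSmall h d v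
  | weight {e : ℕ} {v : ∀ c, Verma c h} : HasWeight h e v → e < d → IsSmall h d v
  | add {v w : ∀ c, Verma c h} : IsSmall h d v → IsSmall h d w → IsSmall h d fun c => v c + w c

theorem IsSmall.vir {d : ℕ} {v : ∀ c, Verma c h} (hv : IsSmall h d v) {n : ℤ} (hn : 0 < n) :
    IsSmall h (d + 1) fun c => TorusBlock.vir c h (-n) (v c) := by
  induction hv with
  | word hv => exact .word (hv.vir hn)
  | weight hv he => exact .weight (hv.vir hn) (by omega)
  | add _ _ ih ih' => simpa only [map_add] using ih.add ih'

/-- The degree is bounded by the weight on either side: a word, however long, is controlled by the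
weight of `u`, and a family containing powers of c by its own weight. -/
theorem IsSmall.hasLead {d e : ℕ} {u v : ∀ c, Verma c h} (hv : IsSmall h d v)
    (hu : IsWordFamily h u) (hu' : HasWeight h e u) (he : e < d) (Δ : ℂ) (k : ℤ) :
    HasLead d (fun c => primary c h Δ k (u c) (v c)) 0 := by
  induction hv with
  | word hv =>
    obtain ⟨a, ha⟩ := hv.exists_hasLead_symm hu' Δ k
    exact ha.of_lt he
  | weight hv he' =>
    obtain ⟨a, ha⟩ := hu.exists_hasLead hv Δ k
    exact ha.of_lt he'
  | add _ _ ih ih' => simpa only [map_add, add_zero] using ih.add ih'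

/-! ### Words in `L_{-m}`, `m ≥ 2`, over sl(2) states, and their contractions -/

theorem isWordFamily_slState (h : ℂ) (j : ℕ) : IsWordFamily h fun c => slState c h j := by
  induction j with
  | zero => exact .vac
  | succ j ih =>
    simp only [slState, pow_succ', Module.End.mul_apply]
    exact ih.vir one_pos

theorem hasWeight_slState (h : ℂ) (j : ℕ) : HasWeight h 0 fun c => slState c h j := by
  induction j with
  | zero => exact .vac
  | succ j ih =>
    simp only [slState, pow_succ', Module.End.mul_apply]
    exact ih.vir_neg_one

theorem slState_succ (c h : ℂ) (j : ℕ) : slState c h (j + 1) = vir c h (-1) (slState c h j) := by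
  simp only [slState, pow_succ', Module.End.mul_apply]

theorem isWordFamily_vir_slState (h : ℂ) (j : ℕ) {m : ℤ} (hm : 0 ≤ m) :
    IsWordFamily h fun c => vir c h m (slState c h j) := by
  induction j generalizing m with
  | zero =>
    simp only [slState, pow_zero, Module.End.one_apply]
    rcases hm.eq_or_lt with rfl | hm
    · simp only [vir_vac_zero]
      exact IsWordFamily.vac.smul h
    · simp only [vir_vac_pos _ h hm]
      exact IsWordFamily.zero
  | succ j ih =>
    simp only [slState_succ, vir_vir_neg _ h m 1, central_neg_one _ hm]
    refine ((ih hm).vir one_pos).add (.add (.smul _ ?_) ?_)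
    · rcases hm.eq_or_lt with rfl | hm
      · exact (isWordFamily_slState h j).vir one_pos
      · exact ih (by omega)
    · simpa only [zero_smul_verma] using IsWordFamily.zero

/-- The state `L_{-m_1} ⋯ L_{-m_r} L_{-1}^j |h⟩`. -/
noncomputable def wordState (c h : ℂ) (l : List ℕ) (j : ℕ) : Verma c h :=
  l.foldr (fun (m : ℕ) x => vir c h (-(m : ℤ)) x) (slState c h j)

theorem wordState_cons (c h : ℂ) (m : ℕ) (l : List ℕ) (j : ℕ) :
    wordState c h (m :: l) j = vir c h (-(m : ℤ)) (wordState c h l j) := rfl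

theorem isWordFamily_wordState (h : ℂ) {l : List ℕ} (hl : ∀ m ∈ l, 2 ≤ m) (j : ℕ) :
    IsWordFamily h fun c => wordState c h l j := by
  induction l with
  | nil => exact isWordFamily_slState h j
  | cons m l ih =>
    have hm := hl m (by simp)
    exact (ih fun n hn => hl n (by simp [hn])).vir (by omega)

theorem hasWeight_wordState (h : ℂ) {l : List ℕ} (hl : ∀ m ∈ l, 2 ≤ m) (j : ℕ) :
    HasWeight h l.length fun c => wordState c h l j := by
  induction l with
  | nil => exact hasWeight_slState h j
  | cons m l ih =>
    have hm := hl m (by simp)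
    exact (ih fun n hn => hl n (by simp [hn])).vir (by omega)

/-- The lists obtained by removing one occurrence of `m`. -/
def removals (m : ℕ) : List ℕ → List (List ℕ)
  | [] => []
  | n :: l => (if m = n then [l] else []) ++ (removals m l).map (n :: ·)

/-- Removals are listed with multiplicity, one for each possible contraction. -/
theorem length_removals (m : ℕ) (l : List ℕ) : (removals m l).length = l.count m := by
  induction l with
  | nil => rfl
  | cons n l ih =>
    rw [removals, List.length_append, List.length_map, ih, List.count_cons]
    rcases eq_or_ne m n with rfl | hmn
    · simp [add_comm]
    · simp [hmn, hmn.symm]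

theorem perm_of_mem_removals {m : ℕ} {l e : List ℕ} (he : e ∈ removals m l) :
    (m :: e).Perm l := by
  induction l generalizing e with
  | nil => simp [removals] at he
  | cons n l ih =>
    rw [removals, List.mem_append, List.mem_map] at he
    rcases he with he | ⟨e', he', rfl⟩
    · split_ifs at he with hmn
      · rw [List.mem_singleton.1 he, hmn]
      · simp at he
    · exact (List.Perm.swap _ _ _).trans ((ih he').cons n)

/-- Contraction of `L_m` with a word, up to families of smaller pairing. -/
theorem exists_vir_wordState (h : ℂ) {m : ℕ} {l : List ℕ} (hl : ∀ n ∈ l, 2 ≤ n) (j : ℕ) :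
    ∃ v, IsSmall h l.length v ∧ ∀ c, vir c h m (wordState c h l j)
      = (c * central 1 m (-m)) • ((removals m l).map fun e => wordState c h e j).sum + v c := by
  induction l with
  | nil =>
    refine ⟨_, .word (isWordFamily_vir_slState h j (Int.natCast_nonneg m)), fun c => ?_⟩
    simp [removals, wordState, smul_zero_verma]
  | cons n l ih =>
    have hn := hl n (by simp)
    have hl' : ∀ k ∈ l, 2 ≤ k := fun k hk => hl k (by simp [hk])
    obtain ⟨v, hv, hv'⟩ := ih hl'
    -- The remainder collects what passes through the first letter and the non-central commutator.
    -- For `m < n` the latter is a word possibly too heavy for the weight bound but free of c, hence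
    -- the two kinds of small family.
    refine ⟨fun c => vir c h (-(n : ℤ)) (v c)
      + ((m : ℂ) + n) • vir c h ((m : ℤ) - n) (wordState c h l j), ?_, fun c => ?_⟩
    · refine (hv.vir (by omega)).add ?_
      rcases le_or_gt n m with hmn | hmn
      · exact .weight (((hasWeight_wordState h hl' j).vir_nonneg (by omega)).smul _)
          (Nat.lt_succ_self _)
      · refine .word (.smul _ ?_)
        rw [← neg_sub]
        exact (isWordFamily_wordState h hl' j).vir (by omega)
    · have hsum : ((removals m (n :: l)).map fun e => wordState c h e j).sum
          = (if m = n then wordState c h l j else 0)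
            + vir c h (-(n : ℤ)) ((removals m l).map fun e => wordState c h e j).sum := by
        rw [removals, List.map_append, List.sum_append, List.map_map, map_list_sum, List.map_map]
        congr 1
        split_ifs <;> simp
      have hcen : central c m (-n) • wordState c h l j
          = (c * central 1 m (-m)) • (if m = n then wordState c h l j else 0) := by
        split_ifs with hmn
        · rw [hmn, ← central_eq_mul]
        · rw [smul_zero_verma, central, if_neg (by omega), zero_smul_verma]
      rw [wordState_cons, vir_vir_neg, hv', hcen, hsum, map_add, map_smul]
      push_cast
      module

theorem hasLead_list_sum {u : ∀ c, Verma c h} {d : ℕ} {k : ℤ} {a : ℂ} {j : ℕ}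
    (L : List (List ℕ))
    (hL : ∀ e ∈ L, HasLead d (fun c => primary c h Δ k (u c) (wordState c h e j)) a) :
    HasLead d (fun c => primary c h Δ k (u c) (L.map fun e => wordState c h e j).sum)
      (L.length * a) := by
  induction L with
  | nil => simpa using HasLead.zero d
  | cons e L ih =>
    have := (hL e (by simp)).add (ih fun e' he' => hL e' (by simp [he']))
    simp only [List.map_cons, List.sum_cons, map_add, List.length_cons]
    push_cast
    convert! this using 1
    ring

/-- The leading coefficient of the norm of a word. -/
noncomputable def wordNorm : List ℕ → ℂ
  | [] => 1
  | m :: l => central 1 m (-m) * (m :: l).count m * wordNorm l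

theorem wordNorm_ne_zero {l : List ℕ} (hl : ∀ m ∈ l, 2 ≤ m) : wordNorm l ≠ 0 := by
  induction l with
  | nil => exact one_ne_zero
  | cons m l ih =>
    refine mul_ne_zero (mul_ne_zero ?_ ?_) (ih fun n hn => hl n (by simp [hn]))
    · have hm := hl m (by simp)
      rw [central, if_pos (by omega)]
      have h1 : (m : ℂ) ≠ 0 := by exact_mod_cast (by omega : m ≠ 0)
      have h2 : ((m : ℂ) ^ 2 - 1) ≠ 0 := by
        rw [sub_ne_zero]
        have : 1 < m ^ 2 := Nat.one_lt_pow two_ne_zero (by omega)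
        exact_mod_cast this.ne'
      have h3 : (1 : ℂ) / 12 ≠ 0 := by norm_num
      push_cast
      exact mul_ne_zero (mul_ne_zero h3 h1) h2
    · simp only [List.count_cons_self]
      exact_mod_cast Nat.succ_ne_zero (l.count m)

/-! ### The sl(2) submodule: norms and independence of c -/

theorem vir_zero_slState (c h : ℂ) (j : ℕ) : vir c h 0 (slState c h j) = (h + j) • slState c h j := by
  induction j with
  | zero => simpa [slState] using vir_vac_zero c h
  | succ j ih =>
    rw [slState_succ, vir_vir_neg, ih, central_neg_one _ le_rfl, zero_sub, map_smul]
    push_cast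
    module

theorem vir_one_slState (c h : ℂ) (j : ℕ) :
    vir c h 1 (slState c h (j + 1)) = ((j + 1) * (2 * h + j)) • slState c h j := by
  induction j with
  | zero =>
    rw [slState_succ, vir_vir_neg, central_neg_one _ zero_le_one, sub_self, vir_zero_slState]
    simp only [slState, pow_zero, Module.End.one_apply]
    rw [vir_vac_pos c h one_pos, map_zero]
    push_cast
    module
  | succ j ih =>
    rw [slState_succ, vir_vir_neg, ih, central_neg_one _ zero_le_one, sub_self, vir_zero_slState,
      map_smul, ← slState_succ]
    push_cast
    module

/-- The matrix elements between the states `L_{-1}^j |h⟩` do not depend on the central charge. -/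
theorem primary_slState (c c' h Δ : ℂ) (k : ℤ) (i j : ℕ) :
    primary c h Δ k (slState c h i) (slState c h j)
      = primary c' h Δ k (slState c' h i) (slState c' h j) := by
  induction i generalizing k j with
  | zero =>
    simp only [slState, pow_zero, Module.End.one_apply]
    induction j generalizing k with
    | zero => simp only [pow_zero, Module.End.one_apply, primary_vac_vac]
    | succ j ih =>
      simp only [pow_succ', Module.End.mul_apply]
      rw [primary_vac_vir_neg _ _ _ _ one_pos, primary_vac_vir_neg _ _ _ _ one_pos, ih]
  | succ i ih =>
    rw [slState_succ, slState_succ, primary_vir_left, primary_vir_left, ih]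
    congr 1
    rcases j with _ | j
    · simp only [slState, pow_zero, Module.End.one_apply]
      rw [vir_vac_pos c h one_pos, vir_vac_pos c' h one_pos, map_zero, map_zero]
    · rw [vir_one_slState, vir_one_slState, map_smul, map_smul, ih]

/-- The norms satisfy the recursion with factor `(j + 1)(2h + j)`, nonzero by the assumption on
`2h`. -/
theorem form_slState_ne_zero (hh : ∀ k : ℕ, 2 * h ≠ -(k : ℂ)) (c : ℂ) (j : ℕ) :
    form c h (slState c h j) (slState c h j) ≠ 0 := by
  induction j with
  | zero =>
    have := (form_spec c h).vac_vac
    simp only [slState, pow_zero, Module.End.one_apply, this]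
    exact one_ne_zero
  | succ j ih =>
    rw [slState_succ, (form_spec c h).adjoint, ← slState_succ, vir_one_slState, map_smul]
    refine mul_ne_zero (mul_ne_zero ?_ ?_) ih
    · exact_mod_cast Nat.succ_ne_zero j
    · intro h0
      exact hh j (eq_neg_of_add_eq_zero_left h0)

/-! ### Leading coefficients between words -/

/-- The leading coefficient of the matrix elements between two words of the same weight. -/
theorem hasLead_wordState (h Δ : ℂ) {l l' : List ℕ} (hl : ∀ m ∈ l, 2 ≤ m)
    (hl' : ∀ m ∈ l', 2 ≤ m) (hlen : l.length = l'.length) (k : ℤ) (i j : ℕ) :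
    HasLead l.length (fun c => primary c h Δ k (wordState c h l i) (wordState c h l' j))
      (if l.Perm l' then
        wordNorm l * primary 0 h Δ k (slState 0 h i) (slState 0 h j) else 0) := by
  induction l generalizing l' with
  | nil =>
    obtain rfl : l' = [] := List.length_eq_zero_iff.1 hlen.symm
    simp only [wordState, List.foldr_nil, primary_slState _ 0 h Δ k, wordNorm, one_mul,
      List.Perm.refl, if_true]
    exact HasLead.const _
  | cons m l ih =>
    have hm := hl m (by simp)
    have hl1 : ∀ n ∈ l, 2 ≤ n := fun n hn => hl n (by simp [hn])
    obtain ⟨v, hv, hv'⟩ := exists_vir_wordState h (m := m) hl' j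
    -- The term from commuting `L_m` with φ is bounded through the shorter word `l`, so it misses
    -- the top degree by one.
    obtain ⟨b, hb⟩ := (isWordFamily_wordState h hl' j).exists_hasLead_symm
      (hasWeight_wordState h hl1 i) Δ (k + m)
    have hsmall := hv.hasLead (isWordFamily_wordState h hl1 i) (hasWeight_wordState h hl1 i)
      (by rw [← hlen]; exact Nat.lt_succ_self _) Δ k
    rw [← hlen] at hsmall
    have hmain := hasLead_list_sum (h := h) (Δ := Δ) (u := fun c => wordState c h l i)
      (d := l.length) (k := k) (j := j)
      (a := if (m :: l).Perm l' then
        wordNorm l * primary 0 h Δ k (slState 0 h i) (slState 0 h j) else 0)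
      (removals m l') (by
        intro e he
        have hp := perm_of_mem_removals he
        have := ih hl1 (l' := e) (fun n hn => hl' n (hp.subset (by simp [hn])))
          (by have := hp.length_eq; simp only [List.length_cons] at this hlen; omega)
        convert! this using 2
        -- All contractions share one leading coefficient: `l` is a permutation of the removal `e`
        -- exactly when `m :: l` is one of `l'`. The number of contractions supplies the
        -- multiplicity in `wordNorm`.
        exact ⟨fun hp' => (hp'.trans hp.symm).cons_inv, fun hp' => (hp'.cons m).trans hp⟩)
    have := ((hmain.id_mul.const_mul (central 1 m (-m))).add hsmall).add
      (hb.succ.const_mul ((Δ - 1) * m - k))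
    convert! this using 1
    · ext c
      rw [wordState_cons, primary_vir_left, hv', map_add, map_smul, smul_eq_mul]
      push_cast
      ring
    · rw [length_removals]
      split_ifs with hp
      · rw [wordNorm, hp.count_eq]
        ring
      · ring

/-- Bounding through the lighter of the two words gives row scaling for every pair, with vanishing
coefficient when the column word is shorter. -/
theorem exists_hasLead_wordState (h Δ : ℂ) {l l' : List ℕ} (hl : ∀ m ∈ l, 2 ≤ m)
    (hl' : ∀ m ∈ l', 2 ≤ m) (k : ℤ) (i j : ℕ) :
    ∃ a, HasLead l.length
      (fun c => primary c h Δ k (wordState c h l i) (wordState c h l' j)) a ∧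
      (l'.length < l.length → a = 0) := by
  by_cases hlt : l'.length < l.length
  · obtain ⟨a, ha⟩ := (isWordFamily_wordState h hl i).exists_hasLead
      (hasWeight_wordState h hl' j) Δ k
    exact ⟨0, ha.of_lt hlt, fun _ => rfl⟩
  · obtain ⟨a, ha⟩ := (isWordFamily_wordState h hl' j).exists_hasLead_symm
      (hasWeight_wordState h hl i) Δ k
    exact ⟨a, ha, fun h => absurd h hlt⟩

end TorusBlock

/-! ### From partitions to words, and the limit of the block coefficients -/

namespace TorusBlock

open Filter Bornology Asymptotics

/-- The parts of a partition different from `1`, in decreasing order. -/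
def bigParts {n : ℕ} (M : n.Partition) : List ℕ :=
  (M.parts.sort (· ≥ ·)).filter (· ≠ 1)

theorem two_le_of_mem_bigParts {n : ℕ} (M : n.Partition) : ∀ m ∈ bigParts M, 2 ≤ m := by
  intro m hm
  rw [bigParts, List.mem_filter, Multiset.mem_sort] at hm
  have h1 := M.parts_pos hm.1
  have h2 : m ≠ 1 := by simpa using hm.2
  omega

theorem coe_bigParts {n : ℕ} (M : n.Partition) :
    (bigParts M : Multiset ℕ) = M.parts.filter (· ≠ 1) := by
  rw [bigParts, ← Multiset.filter_coe, Multiset.sort_eq]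

/-- The fixed level `n` recovers the number of ones. -/
theorem eq_of_bigParts_perm {n : ℕ} {M N : n.Partition} (h : (bigParts M).Perm (bigParts N)) :
    M = N := by
  have h1 := Multiset.coe_eq_coe.2 h
  rw [coe_bigParts, coe_bigParts] at h1
  have hM := sum_filter_add_count_one M
  have hN := sum_filter_add_count_one N
  rw [h1] at hM
  refine Nat.Partition.ext ?_
  rw [← filter_add_replicate_count_one M.parts, ← filter_add_replicate_count_one N.parts, h1,
    show M.parts.count 1 = N.parts.count 1 by omega]

/-- In a decreasing list of positive numbers the ones come last, so the powers of `L_{-1}` act first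
on `|h⟩`. -/
theorem eq_filter_append_replicate {l : List ℕ} (hl : l.Pairwise (· ≥ ·)) (hpos : ∀ m ∈ l, 0 < m) :
    l = l.filter (· ≠ 1) ++ List.replicate (l.count 1) 1 := by
  induction l with
  | nil => rfl
  | cons n l ih =>
    rw [List.pairwise_cons] at hl
    rcases eq_or_ne n 1 with rfl | hn
    · have h1 : ∀ m ∈ l, m = 1 := fun m hm =>
        le_antisymm (hl.1 m hm) (hpos m (by simp [hm]))
      rw [List.eq_replicate_of_mem h1]
      simp [List.replicate_succ]
    · have := ih hl.2 fun m hm => hpos m (by simp [hm])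
      rw [List.filter_cons_of_pos (by simpa using hn), List.count_cons_of_ne hn, List.cons_append,
        ← this]

theorem descendant_eq_wordState (c h : ℂ) {n : ℕ} (M : n.Partition) :
    descendant c h M = wordState c h (bigParts M) (M.parts.count 1) := by
  have hone : ∀ j : ℕ, (List.replicate j 1).foldr
      (fun (m : ℕ) x => vir c h (-(m : ℤ)) x) (vac c h) = slState c h j := by
    intro j
    induction j with
    | zero => rfl
    | succ j ih => rw [List.replicate_succ, List.foldr_cons, ih, slState_succ, Nat.cast_one]
  have hsort := eq_filter_append_replicate (Multiset.pairwise_sort M.parts (· ≥ ·))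
    (fun m hm => M.parts_pos ((Multiset.mem_sort (· ≥ ·)).1 hm))
  have hcount : (M.parts.sort (· ≥ ·)).count 1 = M.parts.count 1 := by
    rw [← Multiset.coe_count, Multiset.sort_eq]
  have hfold : descendant c h M = (M.parts.sort (· ≥ ·)).foldr
      (fun (m : ℕ) x => vir c h (-(m : ℤ)) x) (vac c h) := by
    rw [descendant]
    generalize M.parts.sort (· ≥ ·) = l
    induction l with
    | nil => rfl
    | cons m l ih =>
      rw [List.foldr_cons, ← ih]
      rfl
  rw [hfold, hsort, List.foldr_append, hcount, hone]
  rfl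

theorem exists_leadMatrix (Δ h : ℂ) (n : ℕ) : ∃ p : Matrix n.Partition n.Partition ℂ,
    (∀ M N, HasLead (bigParts M).length (fun c => primaryMatrix Δ h c n M N) (p M N)) ∧
    (∀ M N, M ≠ N → (bigParts N).length ≤ (bigParts M).length → p M N = 0) ∧
    ∀ M, p M M = wordNorm (bigParts M) * primary 0 h Δ 0 (slState 0 h (M.parts.count 1))
      (slState 0 h (M.parts.count 1)) := by
  have key : ∀ M N : n.Partition, ∃ a,
      HasLead (bigParts M).length (fun c => primaryMatrix Δ h c n M N) a ∧
      (M ≠ N → (bigParts N).length ≤ (bigParts M).length → a = 0) ∧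
      (M = N → a = wordNorm (bigParts M) * primary 0 h Δ 0 (slState 0 h (M.parts.count 1))
        (slState 0 h (M.parts.count 1))) := by
    intro M N
    simp only [primaryMatrix, Matrix.of_apply, descendant_eq_wordState]
    have hM := two_le_of_mem_bigParts M
    have hN := two_le_of_mem_bigParts N
    by_cases hlen : (bigParts M).length = (bigParts N).length
    · refine ⟨_, hasLead_wordState h Δ hM hN hlen _ _ _, fun hne _ => ?_, fun h => ?_⟩
      · exact if_neg fun hp => hne (eq_of_bigParts_perm hp)
      · rw [← h, if_pos (List.Perm.refl _)]
    · obtain ⟨a, ha, ha'⟩ := exists_hasLead_wordState h Δ hM hN 0 (M.parts.count 1)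
        (N.parts.count 1)
      exact ⟨a, ha, fun _ hle => ha' (lt_of_le_of_ne hle (Ne.symm hlen)),
        fun h => absurd (by rw [h]) hlen⟩
  choose p hp using key
  exact ⟨Matrix.of p, fun M N => (hp M N).1, fun M N => (hp M N).2.1, fun M => (hp M M).2.2 rfl⟩

theorem gram_eq_primaryMatrix (c h : ℂ) (n : ℕ) : gram c h n = primaryMatrix 0 h c n := by
  rw [gram, primaryMatrix, form_eq_primary]

theorem virasoroCoeff_eq_trace (Δ h c : ℂ) (n : ℕ) :
    virasoroCoeff Δ h c n = ((primaryMatrix 0 h c n)⁻¹ * primaryMatrix Δ h c n).trace := by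
  simp only [virasoroCoeff, gram_eq_primaryMatrix, Matrix.trace, Matrix.diag_apply,
    Matrix.mul_apply]
  refine Finset.sum_congr rfl fun M _ => Finset.sum_congr rfl fun N _ => ?_
  congr 1
  simp only [primaryMatrix, Matrix.of_apply]
  -- The entrywise sum pairs `B⁻¹` with the transpose of `P`; the zero mode is symmetric.
  rw [primary_symm, neg_zero]

theorem globalCoeff_eq (Δ h c c' : ℂ) (n : ℕ) : globalCoeff Δ h c n = globalCoeff Δ h c' n := by
  simp only [globalCoeff, form_eq_primary, primary_slState c c']

theorem hasLimit_virasoroCoeff {Δ h : ℂ} (hh : ∀ k : ℕ, 2 * h ≠ -(k : ℂ)) (n : ℕ) :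
    (∀ᶠ c in cobounded ℂ, IsUnit (gram c h n).det) ∧
      HasLimit (fun c => virasoroCoeff Δ h c n)
        (∑ k ∈ Finset.range (n + 1), (cardNoOnes (n - k) : ℂ) * globalCoeff Δ h 0 k) := by
  obtain ⟨b, hb, hb0, hbd⟩ := exists_leadMatrix 0 h n
  obtain ⟨p, hp, hp0, hpd⟩ := exists_leadMatrix Δ h n
  have hnorm : ∀ M : n.Partition, wordNorm (bigParts M) ≠ 0 := fun M =>
    wordNorm_ne_zero (two_le_of_mem_bigParts M)
  have hd : ∀ M, b M M ≠ 0 := by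
    intro M
    rw [hbd, ← form_eq_primary]
    exact mul_ne_zero (hnorm M) (form_slState_ne_zero hh 0 _)
  obtain ⟨h1, h2⟩ := hasLimit_trace_inv_mul hb hp hb0 hp0 hd
  simp only [gram_eq_primaryMatrix, virasoroCoeff_eq_trace]
  refine ⟨h1, ?_⟩
  rw [← sum_count_one]
  convert! h2 using 1
  refine Finset.sum_congr rfl fun M _ => ?_
  -- `wordNorm` does not depend on Δ, so it cancels between numerator and Gram entry.
  rw [hbd, hpd, globalCoeff, form_eq_primary, mul_div_mul_left _ _ (hnorm M)]

end TorusBlock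

theorem proposition3p1 (Δ h : ℂ) (hh : ∀ k : ℕ, 2 * h ≠ -(k : ℂ)) :
    (∀ n : ℕ, ∀ᶠ c : ℂ in Bornology.cobounded ℂ, IsUnit (TorusBlock.gram c h n).det) ∧
    ∃ L : PowerSeries ℂ,
      (∀ L' : PowerSeries ℂ, TorusBlock.IsLightBlock Δ h L' ↔ L' = L) ∧
      ∀ c₀ : ℂ,
        L = (1 - PowerSeries.X) * TorusBlock.eulerFunction⁻¹ * TorusBlock.globalBlock Δ h c₀ ∧
        ∀ n : ℕ, PowerSeries.coeff n L =
          ∑ k ∈ Finset.range (n + 1),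
            (TorusBlock.cardNoOnes (n - k) : ℂ) * TorusBlock.globalCoeff Δ h c₀ k := by
  have hlim := fun n => TorusBlock.hasLimit_virasoroCoeff (Δ := Δ) hh n
  -- Central charge 0 is an arbitrary reference point; `globalCoeff_eq` transfers the result to any
  -- `c₀`.
  refine ⟨fun n => (hlim n).1, PowerSeries.mk fun n => ∑ k ∈ Finset.range (n + 1),
    (TorusBlock.cardNoOnes (n - k) : ℂ) * TorusBlock.globalCoeff Δ h 0 k, fun L' => ?_,
    fun c₀ => ?_⟩
  · constructor
    · intro hL
      ext n
      rw [PowerSeries.coeff_mk]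
      exact TorusBlock.HasLimit.unique (hL n) (hlim n).2
    · rintro rfl n
      rw [PowerSeries.coeff_mk]
      exact (hlim n).2
  · have hcoeff : ∀ n : ℕ, ∑ k ∈ Finset.range (n + 1),
        (TorusBlock.cardNoOnes (n - k) : ℂ) * TorusBlock.globalCoeff Δ h 0 k
        = ∑ k ∈ Finset.range (n + 1),
          (TorusBlock.cardNoOnes (n - k) : ℂ) * TorusBlock.globalCoeff Δ h c₀ k := fun n =>
      Finset.sum_congr rfl fun k _ => by rw [TorusBlock.globalCoeff_eq Δ h 0 c₀]
    refine ⟨?_, fun n => by rw [PowerSeries.coeff_mk, hcoeff]⟩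
    ext n
    rw [← TorusBlock.mk_cardNoOnes_eq, PowerSeries.coeff_mk, PowerSeries.coeff_mul, hcoeff,
      ← Finset.Nat.sum_antidiagonal_eq_sum_range_succ_mk
        (f := fun i => (TorusBlock.cardNoOnes i.2 : ℂ) * TorusBlock.globalCoeff Δ h c₀ i.1),
      ← Finset.Nat.sum_antidiagonal_swap]
    simp [TorusBlock.globalBlock]
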